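/- **Setting.** Let $K\in\mathbb R^{m\times n}$ with $K^TK$ invertible, $K^\dagger=(K^TK)^{-1}K^T$, and $\beta\ge 0$. For targets $y_1,\dots,y_T\in\mathbb R^m$ and actions $x_1,\dots,x_T\in\mathbb R^n$, $x_0=0$, the cost is $\sum_{t=1}^T\big(\tfrac12\|y_t-Kx_t\|_2^2+\beta\|x_t-x_{t-1}\|_1\big)$. Let $\mathrm{cost}(OPT)$ be its minimum over all $(x_1,\dots,x_T)$ and $\mathrm{cost}(STA)=\min_{x\in\mathbb R^n}\ \sum_{t=1}^T\tfrac12\|y_t-Kx\|_2^2+\beta\|x\|_1$. *Stochastic prediction-error model.* Let $e(1),e(2),\dots$ be i.i.d. random vectors in $\mathbb R^m$ with mean $0$ and positive definite covariance $R_e$, and let $f:\mathbb N\to\mathbb R^{m\times m}$ with $f(0)=I$. Given an instance $\hat y=(\hat y_t)_{t\ge1}$ (arbitrary, deterministic), $y_t=\hat y_t+\sum_{s=1}^t f(t-s)e(s)$, and the prediction of $y_t$ made at time $\tau<t$ is $y_{t|\tau}=\hat y_t+\sum_{s=1}^{\tau}f(t-s)e(s)$. A (possibly randomized) online algorithm starts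 at $x_0=0$ and chooses $x_t$ as a measurable function of internal randomness independent of $e$ and of the information at time $t-1$ (all predictions made up to time $t-1$; given $\hat y$, equivalently $e(1),\dots,e(t-1)$). An algorithm is *constant competitive* if there is $C$ with $\mathbb E[\mathrm{cost}(ALG)]\le C\,\mathbb E[\mathrm{cost}(OPT)]$ for all $T$ and $\hat y$ (all expectations finite), and has *sublinear regret* if $\sup_{\hat y}\mathbb E[\mathrm{cost}(ALG)-\mathrm{cost}(STA)]\le\rho(T)$ for some $\rho(T)=o(T)$ (expectations finite). *AFHC.* For $w\ge0$ and $0\le k\le w$, $\mathrm{FHC}^{(k)}(w+1)$ does the following at each $\tau\in[-w,T]$ with $\tau\equiv k\pmod{w+1}$: with $a=\max(\tau,1)$ and $b=\min(\tau+w,T)$, it chooses $x_a,\dots,x_b$ to minimize $\sum_{t=a}^{b}\tfrac12\|y_{t|a-1}-Kx_t\|_2^2+\beta\|x_t-x_{t-1}\|_1$, where $x_{a-1}$ is its preceding action ($x_0=0$). $\mathrm{AFHC}(w+1)$ plays the average of the actions of the $w+1$ algorithms $\mathrm{FHC}^{(k)}(w+1)$. *Constants.* Let $\|K^\dagger\|=\sup_{\|v\|_2\le1}\|K^\dagger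 v\|_1$, $B=\beta\|K^\dagger\|$, $\|f_w\|^2=\mathrm{tr}\big(R_e\sum_{s=0}^w f(s)^Tf(s)\big)$, $F(w)=\mathrm{tr}\big(R_e\sum_{s=0}^w(w-s+1)f(s)^TKK^\dagger f(s)\big)$, $$V_w=\frac{B\|f_w\|+3B^2}{w+1}+\frac{F(w)}{2(w+1)},$$ and $S(T)=\mathbb E\sum_{t=1}^T\|KK^\dagger(y_t-\bar y)\|_2^2$ with $\bar y=\frac1T\sum_{t=1}^Ty_t$ (this depends on $\hat y$). **Theorem.** (a) Every online algorithm satisfies $\mathbb E[\mathrm{cost}(ALG)]\ge\frac T2\mathrm{tr}(R_e)$ for all $T$ and $\hat y$. (Hence, for $m\ge1$, constant competitiveness is impossible unless $\inf_{\hat y}\mathbb E[\mathrm{cost}(OPT)]=\Omega(T)$, and sublinear regret is impossible unless $\inf_{\hat y}\mathbb E[\mathrm{cost}(STA)]=\Omega(T)$.) Moreover, for every fixed window parameter $w\ge0$ (independent of $T$): (b) for all $T$ and $\hat y$, $\mathrm{cost}(\mathrm{AFHC}(w+1))$ and $\mathrm{cost}(OPT)$ are integrable and $\mathbb E[\mathrm{cost}(\mathrm{AFHC}(w+1))-\mathrm{cost}(OPT)]\le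 V_wT$; (c) if some online algorithm is constant competitive, then $\mathrm{AFHC}(w+1)$ is constant competitive; if $\beta>0$, then $\mathrm{AFHC}(w+1)$ is always constant competitive; (d) if $\inf_{\hat y}S(T)\ge(4V_w+16B^2)\,T-o(T)$, then $\mathrm{AFHC}(w+1)$ has sublinear regret. In particular, if $\beta>0$ (or some online algorithm is constant competitive) and the condition in (d) holds for some fixed $w$, then AFHC with that constant-size window simultaneously has sublinear expected regret and a constant expected competitive ratio. -/

import Mathlib

open MeasureTheory ProbabilityTheory Filter Asymptotics

noncomputable section

namespace OCOPred

variable {m n : ℕ} {Ω : Type*}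

/-! ### The tracking problem with switching costs -/

/-- The squared Euclidean norm of a vector. -/
def sqNorm {d : ℕ} (v : Fin d → ℝ) : ℝ := ∑ i, v i ^ 2

/-- The `ℓ¹` norm of a vector. -/
def l1Norm {d : ℕ} (v : Fin d → ℝ) : ℝ := ∑ i, |v i|

/-- Cost over the times `a, …, b` (with `1 ≤ a`) of the action sequence `x` against the
targets `y`: tracking cost `½‖y_t - K x_t‖₂²` plus switching cost `β‖x_t - x_{t-1}‖₁`. -/
def costOn (K : Matrix (Fin m) (Fin n) ℝ) (β : ℝ) (a b : ℕ)
    (y : ℕ → Fin m → ℝ) (x : ℕ → Fin n → ℝ) : ℝ :=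
  ∑ t ∈ Finset.Icc a b,
    ((1 / 2 : ℝ) * sqNorm (y t - K.mulVec (x t)) + β * l1Norm (x t - x (t - 1)))

/-- Cost over the horizon `1, …, T`. -/
def cost (K : Matrix (Fin m) (Fin n) ℝ) (β : ℝ) (T : ℕ)
    (y : ℕ → Fin m → ℝ) (x : ℕ → Fin n → ℝ) : ℝ :=
  costOn K β 1 T y x

/-- Cost of the offline optimal dynamic solution (all sequences start from `x_0 = 0`). -/
def optCost (K : Matrix (Fin m) (Fin n) ℝ) (β : ℝ) (T : ℕ) (y : ℕ → Fin m → ℝ) : ℝ :=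
  ⨅ x : {x : ℕ → Fin n → ℝ // x 0 = 0}, cost K β T y x.1

/-- Cost of the offline optimal static solution (one switch, from `0` to `x`). -/
def staCost (K : Matrix (Fin m) (Fin n) ℝ) (β : ℝ) (T : ℕ) (y : ℕ → Fin m → ℝ) : ℝ :=
  ⨅ x : Fin n → ℝ,
    (∑ t ∈ Finset.Icc 1 T, (1 / 2 : ℝ) * sqNorm (y t - K.mulVec x)) + β * l1Norm x

/-! ### The stochastic prediction error model -/

/-- `y_{t|τ}`: the prediction of the target `y_t` made at time `τ`, given the time-zero
predictions `yhat` and the realization `e` of the per-step noise. Thus `y_{t|0} = yhat t`, and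
`y_t - y_{t|τ} = ∑_{s=τ+1}^t f(t-s) e(s)` for `τ < t`; for `τ ≥ t` this is `y_t` itself. -/
def pred (f : ℕ → Matrix (Fin m) (Fin m) ℝ) (yhat e : ℕ → Fin m → ℝ) (τ t : ℕ) : Fin m → ℝ :=
  yhat t + ∑ s ∈ Finset.Icc 1 (min τ t), (f (t - s)).mulVec (e s)

/-- The realized target `y_t = yhat_t + ∑_{s=1}^t f(t-s) e(s)`. -/
def target (f : ℕ → Matrix (Fin m) (Fin m) ℝ) (yhat e : ℕ → Fin m → ℝ) (t : ℕ) : Fin m → ℝ :=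
  yhat t + ∑ s ∈ Finset.Icc 1 t, (f (t - s)).mulVec (e s)

/-- The per-step noise terms `e(1), e(2), …` are i.i.d., centered, square integrable, with positive
definite covariance matrix `R`. (The entry `e 0` is never used.) -/
structure IsNoise [MeasurableSpace Ω] (μ : Measure Ω) (R : Matrix (Fin m) (Fin m) ℝ)
    (e : ℕ → Ω → Fin m → ℝ) : Prop where
  indep : iIndepFun (fun s : ℕ => e (s + 1)) μ
  ident : ∀ s ≥ 1, IdentDistrib (e s) (e 1) μ μ
  measurable : ∀ s ≥ 1, Measurable (e s)
  memLp : ∀ s ≥ 1, MemLp (e s) 2 μ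
  mean : ∀ s ≥ 1, ∀ i, ∫ ω, e s ω i ∂μ = 0
  cov : ∀ s ≥ 1, ∀ i j, ∫ ω, e s ω i * e s ω j ∂μ = R i j
  posDef : R.PosDef

/-! ### Averaging Fixed Horizon Control -/

/-- `x` is a run of the `k`-th Fixed Horizon Control algorithm with window `w + 1` on the
horizon `1, …, T`, where `p τ t` is the prediction of `y_t` made at time `τ`. At each
`τ ≡ k mod (w + 1)` in `[-w, T]` the actions at the times `t` of `[τ, τ + w] ∩ [1, T]` are
planned optimally from the preceding action, with the predictions available before the target at
the first planned time is revealed; the actions at nonpositive times are `0`. -/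
def IsFHC (K : Matrix (Fin m) (Fin n) ℝ) (β : ℝ) (T w k : ℕ) (p : ℕ → ℕ → Fin m → ℝ)
    (x : ℕ → Fin n → ℝ) : Prop :=
  x 0 = 0 ∧
  ∀ τ : ℤ, -(w : ℤ) ≤ τ → τ ≤ T → τ ≡ k [ZMOD (w + 1)] →
    ∀ a b : ℕ, (a : ℤ) = max τ 1 → (b : ℤ) = min (τ + w) T →
      ∀ x' : ℕ → Fin n → ℝ, x' (a - 1) = x (a - 1) →
        costOn K β a b (p (a - 1)) x ≤ costOn K β a b (p (a - 1)) x'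

/-- The actions of the `k`-th Fixed Horizon Control algorithm. (For `Kᵀ K` invertible all the
planning problems are strictly convex and coercive in the planned actions, so that a run exists
and is unique at the times `0, …, T`.) -/
def fhc (K : Matrix (Fin m) (Fin n) ℝ) (β : ℝ) (T w k : ℕ) (p : ℕ → ℕ → Fin m → ℝ) :
    ℕ → Fin n → ℝ :=
  Classical.epsilon (IsFHC K β T w k p)

/-- The actions of Averaging Fixed Horizon Control with window `w + 1`. -/
def afhcAction (K : Matrix (Fin m) (Fin n) ℝ) (β : ℝ) (T w : ℕ) (p : ℕ → ℕ → Fin m → ℝ)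
    (t : ℕ) : Fin n → ℝ :=
  (1 / ((w : ℝ) + 1)) • ∑ k ∈ Finset.range (w + 1), fhc K β T w k p t

/-! ### Online algorithms and their performance -/

/-- An algorithm yields, for each horizon `T` and each specification `yhat` of the instance, a
random sequence of actions. -/
abbrev Alg (m n : ℕ) (Ω : Type*) : Type _ := ℕ → (ℕ → Fin m → ℝ) → ℕ → Ω → Fin n → ℝ

/-- AFHC with window `w + 1` in the prediction error model. -/
def afhc (K : Matrix (Fin m) (Fin n) ℝ) (β : ℝ) (f : ℕ → Matrix (Fin m) (Fin m) ℝ)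
    (e : ℕ → Ω → Fin m → ℝ) (w : ℕ) : Alg m n Ω :=
  fun T yhat t ω => afhcAction K β T w (pred f yhat (fun s => e s ω)) t

/-- The random cost of an algorithm. -/
def algCost (K : Matrix (Fin m) (Fin n) ℝ) (β : ℝ) (f : ℕ → Matrix (Fin m) (Fin m) ℝ)
    (e : ℕ → Ω → Fin m → ℝ) (A : Alg m n Ω) (T : ℕ) (yhat : ℕ → Fin m → ℝ) (ω : Ω) : ℝ :=
  cost K β T (target f yhat (fun s => e s ω)) (fun t => A T yhat t ω)

/-- The random cost of the dynamic optimum. -/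
def optCostAt (K : Matrix (Fin m) (Fin n) ℝ) (β : ℝ) (f : ℕ → Matrix (Fin m) (Fin m) ℝ)
    (e : ℕ → Ω → Fin m → ℝ) (T : ℕ) (yhat : ℕ → Fin m → ℝ) (ω : Ω) : ℝ :=
  optCost K β T (target f yhat (fun s => e s ω))

/-- The random cost of the static optimum. -/
def staCostAt (K : Matrix (Fin m) (Fin n) ℝ) (β : ℝ) (f : ℕ → Matrix (Fin m) (Fin m) ℝ)
    (e : ℕ → Ω → Fin m → ℝ) (T : ℕ) (yhat : ℕ → Fin m → ℝ) (ω : Ω) : ℝ :=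
  staCost K β T (target f yhat (fun s => e s ω))

/-- A (possibly randomized) online algorithm: it starts at `0`, and its action at time `t` is a
function of internal randomness `𝒢` independent of the noise, and of the noise at times
`1, …, t - 1`. Given `yhat`, that noise is equivalent to all predictions made at times
`0, …, t - 1`, together with the targets revealed by then. -/
def IsOnline [mΩ : MeasurableSpace Ω] (μ : Measure Ω) (e : ℕ → Ω → Fin m → ℝ)
    (A : Alg m n Ω) : Prop :=
  ∀ (T : ℕ) (yhat : ℕ → Fin m → ℝ),
    (∀ ω, A T yhat 0 ω = 0) ∧
    ∃ 𝒢 : MeasurableSpace Ω, 𝒢 ≤ mΩ ∧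
      Indep 𝒢 (⨆ s ≥ 1, MeasurableSpace.comap (e s) inferInstance) μ ∧
      ∀ t ∈ Finset.Icc 1 T,
        Measurable[𝒢 ⊔ ⨆ s ∈ Finset.Ico 1 t, MeasurableSpace.comap (e s) inferInstance]
          (A T yhat t)

/-- Constant expected competitive ratio:
`sup_{yhat} E[cost(ALG)] / E[cost(OPT)] ≤ C` with `C` independent of `T`. -/
def ConstantCompetitive [MeasurableSpace Ω] (μ : Measure Ω) (K : Matrix (Fin m) (Fin n) ℝ) (β : ℝ)
    (f : ℕ → Matrix (Fin m) (Fin m) ℝ) (e : ℕ → Ω → Fin m → ℝ) (A : Alg m n Ω) : Prop :=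
  ∃ C : ℝ, ∀ (T : ℕ) (yhat : ℕ → Fin m → ℝ),
    Integrable (algCost K β f e A T yhat) μ ∧ Integrable (optCostAt K β f e T yhat) μ ∧
    ∫ ω, algCost K β f e A T yhat ω ∂μ ≤ C * ∫ ω, optCostAt K β f e T yhat ω ∂μ

/-- Sublinear expected regret: `sup_{yhat} E[cost(ALG) - cost(STA)] ≤ ρ(T)` with `ρ(T) = o(T)`. -/
def SublinearRegret [MeasurableSpace Ω] (μ : Measure Ω) (K : Matrix (Fin m) (Fin n) ℝ) (β : ℝ)
    (f : ℕ → Matrix (Fin m) (Fin m) ℝ) (e : ℕ → Ω → Fin m → ℝ) (A : Alg m n Ω) : Prop :=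
  ∃ ρ : ℕ → ℝ, ρ =o[atTop] (fun T : ℕ => (T : ℝ)) ∧
    ∀ (T : ℕ) (yhat : ℕ → Fin m → ℝ),
      Integrable (algCost K β f e A T yhat) μ ∧ Integrable (staCostAt K β f e T yhat) μ ∧
      ∫ ω, (algCost K β f e A T yhat ω - staCostAt K β f e T yhat ω) ∂μ ≤ ρ T

/-! ### The constants of the model -/

/-- The Moore–Penrose pseudoinverse of a matrix with full column rank. -/
def pinv (K : Matrix (Fin m) (Fin n) ℝ) : Matrix (Fin n) (Fin m) ℝ :=
  (K.transpose * K)⁻¹ * K.transpose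

/-- The operator norm of `K†` from `ℓ²` to `ℓ¹`. -/
def pinvNorm (K : Matrix (Fin m) (Fin n) ℝ) : ℝ :=
  sSup {r : ℝ | ∃ v : Fin m → ℝ, sqNorm v ≤ 1 ∧ r = l1Norm ((pinv K).mulVec v)}

/-- `‖f_w‖² = tr(R_e ∑_{s=0}^w f(s)ᵀ f(s))`, square root taken. -/
def fNorm (R : Matrix (Fin m) (Fin m) ℝ) (f : ℕ → Matrix (Fin m) (Fin m) ℝ) (w : ℕ) : ℝ :=
  Real.sqrt (R * ∑ s ∈ Finset.range (w + 1), (f s).transpose * f s).trace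

/-- `F(w) = tr(R_e ∑_{s=0}^w (w - s + 1) f(s)ᵀ K K† f(s))`. -/
def bigF (K : Matrix (Fin m) (Fin n) ℝ) (R : Matrix (Fin m) (Fin m) ℝ)
    (f : ℕ → Matrix (Fin m) (Fin m) ℝ) (w : ℕ) : ℝ :=
  (R * ∑ s ∈ Finset.range (w + 1),
    ((w : ℝ) - (s : ℝ) + 1) • ((f s).transpose * (K * pinv K) * f s)).trace

/-- `B = β ‖K†‖`. -/
def constB (K : Matrix (Fin m) (Fin n) ℝ) (β : ℝ) : ℝ := β * pinvNorm K

/-- `V = (B ‖f_w‖ + 3 B²) / (w + 1) + F(w) / (2 (w + 1))`. -/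
def constV (K : Matrix (Fin m) (Fin n) ℝ) (β : ℝ) (R : Matrix (Fin m) (Fin m) ℝ)
    (f : ℕ → Matrix (Fin m) (Fin m) ℝ) (w : ℕ) : ℝ :=
  (constB K β * fNorm R f w + 3 * constB K β ^ 2) / ((w : ℝ) + 1)
    + bigF K R f w / (2 * ((w : ℝ) + 1))

/-- `∑_{t=1}^T ‖K K† (y_t - ȳ)‖²` with `ȳ = (1/T) ∑_{t=1}^T y_t`. -/
def spread (K : Matrix (Fin m) (Fin n) ℝ) (T : ℕ) (y : ℕ → Fin m → ℝ) : ℝ :=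
  ∑ t ∈ Finset.Icc 1 T,
    sqNorm ((K * pinv K).mulVec (y t - (1 / (T : ℝ)) • ∑ u ∈ Finset.Icc 1 T, y u))

/-- `S(T) = E ∑_{t=1}^T ‖K K† (y_t - ȳ)‖²`. -/
def expSpread [MeasurableSpace Ω] (μ : Measure Ω) (K : Matrix (Fin m) (Fin n) ℝ)
    (f : ℕ → Matrix (Fin m) (Fin m) ℝ) (e : ℕ → Ω → Fin m → ℝ) (T : ℕ)
    (yhat : ℕ → Fin m → ℝ) : ℝ :=
  ∫ ω, spread K T (target f yhat (fun s => e s ω)) ∂μ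

end OCOPred

end

noncomputable section

namespace OCOPred

variable {m n : ℕ} {Ω : Type*}

/-! ### Norms -/

/-! Lower bound (a): since `f 0 = 1`, the tracking residual at time `t` is `e t` plus a vector known
at time `t - 1`. The two are independent and `e t` is centred, so the mean square is at least the
trace of `R` (`IsNoise.variance_le_tracking`).

Competitive difference (b): in one window, a plan that is optimal for predictions `q` is compared
with the offline optimum, restarted from the plan's initial action. Optimality and strong convexity
give a quadratic gain (`OptOn.add_le`), which absorbs the cross term between `y - q` and the
actions. What remains is half the squared prediction error, projected onto the range of `K`, plus
one switching cost for the restart (`OptOn.costOn_le`). The restart distance is controlled by the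
first-order conditions: the gradients of the tracking cost are bounded by multiples of `β`, so both
actions lie near the pseudoinverse images of their targets (`OptOn.mul_l1Norm_sub_le`). By convexity
AFHC costs at most the average of the FHC costs. As `k` varies, a fixed time occupies each window
position exactly once (`sum_windowPos`), so restarts are charged once per time and the error
variances add up to `bigF`.

Competitive ratio (c): the additive bound is multiplicative as soon as the expected optimum grows
linearly. A constant competitive online algorithm forces this growth through (a). If `β > 0`, weak
duality gives it directly (`sum_dotProduct_sub_le_cost`): a small, bounded, centred function of `e
t` is dual feasible, and of the increment of the targets it correlates only with `e t` itself
(`IsNoise.exists_linear_le_integral_optCostAt`).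

Regret (d): playing `pinv K` applied to each target is a competitor for the dynamic optimum. It
beats the static optimum by a quarter of the spread, up to `4 B²` per step
(`optCost_le_staCost_add`). Adding (b) makes the linear terms cancel. -/

open Matrix in
lemma sqNorm_eq_dotProduct {d : ℕ} (v : Fin d → ℝ) : sqNorm v = v ⬝ᵥ v := by
  simp [sqNorm, dotProduct, sq]

lemma sqNorm_nonneg {d : ℕ} (v : Fin d → ℝ) : 0 ≤ sqNorm v :=
  Finset.sum_nonneg fun _ _ => sq_nonneg _

@[simp] lemma sqNorm_zero {d : ℕ} : sqNorm (0 : Fin d → ℝ) = 0 := by simp [sqNorm]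

@[simp] lemma sqNorm_neg {d : ℕ} (v : Fin d → ℝ) : sqNorm (-v) = sqNorm v := by simp [sqNorm]

lemma sqNorm_sub_comm {d : ℕ} (u v : Fin d → ℝ) : sqNorm (u - v) = sqNorm (v - u) := by
  rw [← neg_sub, sqNorm_neg]

lemma sqNorm_smul {d : ℕ} (c : ℝ) (v : Fin d → ℝ) : sqNorm (c • v) = c ^ 2 * sqNorm v := by
  simp [sqNorm, mul_pow, Finset.mul_sum]

lemma sqNorm_add {d : ℕ} (u v : Fin d → ℝ) :
    sqNorm (u + v) = sqNorm u + 2 * (u ⬝ᵥ v) + sqNorm v := by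
  simp only [sqNorm_eq_dotProduct, add_dotProduct, dotProduct_add]
  rw [dotProduct_comm v u]; ring

lemma sqNorm_sub {d : ℕ} (u v : Fin d → ℝ) :
    sqNorm (u - v) = sqNorm u - 2 * (u ⬝ᵥ v) + sqNorm v := by
  rw [sub_eq_add_neg, sqNorm_add, sqNorm_neg, dotProduct_neg]; ring

lemma sqNorm_add_le {d : ℕ} (u v : Fin d → ℝ) :
    sqNorm (u + v) ≤ 2 * sqNorm u + 2 * sqNorm v := by
  have := sqNorm_nonneg (u - v)
  rw [sqNorm_sub] at this
  rw [sqNorm_add]; linarith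

lemma sqNorm_sub_le {d : ℕ} (u v : Fin d → ℝ) :
    sqNorm (u - v) ≤ 2 * sqNorm u + 2 * sqNorm v := by
  simpa [sub_eq_add_neg] using sqNorm_add_le u (-v)

lemma dotProduct_le_half_sqNorm {d : ℕ} (u v : Fin d → ℝ) :
    u ⬝ᵥ v ≤ 1 / 2 * sqNorm u + 1 / 2 * sqNorm v := by
  have := sqNorm_nonneg (u - v)
  rw [sqNorm_sub] at this
  linarith

lemma eq_zero_of_sqNorm_eq_zero {d : ℕ} {v : Fin d → ℝ} (h : sqNorm v = 0) : v = 0 := by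
  rw [sqNorm_eq_dotProduct] at h
  exact dotProduct_self_eq_zero.1 h

/-- The last term is the source of all strong convexity used below. -/
lemma sqNorm_segment {d : ℕ} (u v : Fin d → ℝ) (θ : ℝ) :
    sqNorm ((1 - θ) • u + θ • v) =
      (1 - θ) * sqNorm u + θ * sqNorm v - θ * (1 - θ) * sqNorm (u - v) := by
  rw [sqNorm_add, sqNorm_sub, sqNorm_smul, sqNorm_smul, smul_dotProduct, dotProduct_smul]
  simp only [smul_eq_mul]; ring

lemma sq_apply_le_sqNorm {d : ℕ} (v : Fin d → ℝ) (i : Fin d) : v i ^ 2 ≤ sqNorm v :=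
  Finset.single_le_sum (f := fun i => v i ^ 2) (fun _ _ => sq_nonneg _) (Finset.mem_univ i)

lemma l1Norm_nonneg {d : ℕ} (v : Fin d → ℝ) : 0 ≤ l1Norm v :=
  Finset.sum_nonneg fun _ _ => abs_nonneg _

@[simp] lemma l1Norm_zero {d : ℕ} : l1Norm (0 : Fin d → ℝ) = 0 := by simp [l1Norm]

@[simp] lemma l1Norm_neg {d : ℕ} (v : Fin d → ℝ) : l1Norm (-v) = l1Norm v := by simp [l1Norm]

lemma l1Norm_sub_comm {d : ℕ} (u v : Fin d → ℝ) : l1Norm (u - v) = l1Norm (v - u) := by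
  rw [← neg_sub, l1Norm_neg]

lemma l1Norm_smul {d : ℕ} (c : ℝ) (v : Fin d → ℝ) : l1Norm (c • v) = |c| * l1Norm v := by
  simp [l1Norm, abs_mul, Finset.mul_sum]

lemma l1Norm_add_le {d : ℕ} (u v : Fin d → ℝ) : l1Norm (u + v) ≤ l1Norm u + l1Norm v := by
  rw [l1Norm, l1Norm, l1Norm, ← Finset.sum_add_distrib]
  exact Finset.sum_le_sum fun i _ => abs_add_le _ _

lemma l1Norm_sub_le {d : ℕ} (u v : Fin d → ℝ) : l1Norm (u - v) ≤ l1Norm u + l1Norm v := by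
  simpa [sub_eq_add_neg] using l1Norm_add_le u (-v)

lemma abs_apply_le_l1Norm {d : ℕ} (v : Fin d → ℝ) (i : Fin d) : |v i| ≤ l1Norm v :=
  Finset.single_le_sum (f := fun i => |v i|) (fun _ _ => abs_nonneg _) (Finset.mem_univ i)

lemma abs_dotProduct_le_mul_l1Norm {d : ℕ} {g : Fin d → ℝ} {c : ℝ} (hg : ∀ i, |g i| ≤ c)
    (v : Fin d → ℝ) : |g ⬝ᵥ v| ≤ c * l1Norm v := by
  rw [l1Norm, Finset.mul_sum]
  refine (Finset.abs_sum_le_sum_abs _ _).trans (Finset.sum_le_sum fun i _ => ?_)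
  rw [abs_mul]
  exact mul_le_mul_of_nonneg_right (hg i) (abs_nonneg _)

lemma continuous_sqNorm {d : ℕ} : Continuous (sqNorm : (Fin d → ℝ) → ℝ) := by
  unfold sqNorm; fun_prop

lemma continuous_l1Norm {d : ℕ} : Continuous (l1Norm : (Fin d → ℝ) → ℝ) := by
  unfold l1Norm; fun_prop

/-! ### The pseudoinverse and the projection onto the range -/

section PseudoInverse

variable {K : Matrix (Fin m) (Fin n) ℝ}

open Matrix

lemma pinv_mul_self (hK : IsUnit (K.transpose * K)) : pinv K * K = 1 := by
  rw [pinv, Matrix.mul_assoc]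
  exact nonsing_inv_mul _ ((isUnit_iff_isUnit_det _).1 hK)

lemma pinv_mulVec_mulVec (hK : IsUnit (K.transpose * K)) (x : Fin n → ℝ) :
    (pinv K).mulVec (K.mulVec x) = x := by
  rw [mulVec_mulVec, pinv_mul_self hK, one_mulVec]

lemma transpose_proj : (K * pinv K).transpose = K * pinv K := by
  rw [pinv, transpose_mul, transpose_mul, transpose_nonsing_inv, transpose_mul,
    transpose_transpose, Matrix.mul_assoc]

lemma proj_mul_proj (hK : IsUnit (K.transpose * K)) : K * pinv K * (K * pinv K) = K * pinv K := by
  rw [Matrix.mul_assoc, ← Matrix.mul_assoc (pinv K), pinv_mul_self hK, Matrix.one_mul]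

lemma pinv_mul_proj (hK : IsUnit (K.transpose * K)) : pinv K * (K * pinv K) = pinv K := by
  rw [← Matrix.mul_assoc, pinv_mul_self hK, Matrix.one_mul]

lemma proj_mulVec_mulVec (hK : IsUnit (K.transpose * K)) (x : Fin n → ℝ) :
    (K * pinv K).mulVec (K.mulVec x) = K.mulVec x := by
  rw [← mulVec_mulVec, pinv_mulVec_mulVec hK]

/-- `K * pinv K` is symmetric and fixes the range of `K`, so actions interact with a target only
through its projection. -/
lemma dotProduct_mulVec_eq_proj (hK : IsUnit (K.transpose * K)) (v : Fin m → ℝ) (x : Fin n → ℝ) :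
    v ⬝ᵥ K.mulVec x = (K * pinv K).mulVec v ⬝ᵥ K.mulVec x := by
  conv_lhs => rw [← proj_mulVec_mulVec hK, dotProduct_mulVec, ← mulVec_transpose, transpose_proj]

/-- Pythagoras for the orthogonal projection onto the range of `K`. -/
lemma sqNorm_sub_mulVec (hK : IsUnit (K.transpose * K)) (v : Fin m → ℝ) (x : Fin n → ℝ) :
    sqNorm (v - K.mulVec x) =
      sqNorm (v - (K * pinv K).mulVec v) + sqNorm ((K * pinv K).mulVec v - K.mulVec x) := by
  have h1 := dotProduct_mulVec_eq_proj hK v x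
  have h2 := dotProduct_mulVec_eq_proj hK v ((pinv K).mulVec v)
  rw [mulVec_mulVec] at h2
  rw [sqNorm_sub, sqNorm_sub, sqNorm_sub, h1, h2, ← sqNorm_eq_dotProduct]
  ring

/-- The pseudoinverse applied to a target, minus the correction from the optimality conditions. -/
lemma eq_pinv_mulVec_sub (hK : IsUnit (K.transpose * K)) (v : Fin m → ℝ) (x : Fin n → ℝ) :
    x = (pinv K).mulVec v
      - (K.transpose * K)⁻¹.mulVec (K.transpose.mulVec (v - K.mulVec x)) := by
  have : (K.transpose * K)⁻¹.mulVec (K.transpose.mulVec (v - K.mulVec x))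
      = (pinv K).mulVec (v - K.mulVec x) := by
    rw [mulVec_mulVec, pinv]
  rw [this, mulVec_sub, pinv_mulVec_mulVec hK]; abel

lemma pinv_mul_transpose_pinv (hK : IsUnit (K.transpose * K)) :
    pinv K * (pinv K).transpose = (K.transpose * K)⁻¹ := by
  conv_lhs => rw [pinv, transpose_mul, transpose_transpose, transpose_nonsing_inv, transpose_mul,
    transpose_transpose, Matrix.mul_assoc, ← Matrix.mul_assoc K.transpose,
    mul_nonsing_inv _ ((isUnit_iff_isUnit_det _).1 hK), Matrix.mul_one]

lemma bddAbove_pinvNorm (K : Matrix (Fin m) (Fin n) ℝ) :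
    BddAbove {r : ℝ | ∃ v : Fin m → ℝ, sqNorm v ≤ 1 ∧ r = l1Norm ((pinv K).mulVec v)} := by
  refine ⟨∑ i, ∑ j, |pinv K i j|, ?_⟩
  rintro r ⟨v, hv, rfl⟩
  refine Finset.sum_le_sum fun i _ => ?_
  rw [mulVec, dotProduct]
  refine (Finset.abs_sum_le_sum_abs _ _).trans (Finset.sum_le_sum fun j _ => ?_)
  rw [abs_mul]
  refine mul_le_of_le_one_right (abs_nonneg _) ?_
  exact abs_le_one_iff_mul_self_le_one.2 (by rw [← sq]; exact (sq_apply_le_sqNorm v j).trans hv)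

lemma pinvNorm_nonneg (K : Matrix (Fin m) (Fin n) ℝ) : 0 ≤ pinvNorm K :=
  le_csSup (bddAbove_pinvNorm K) ⟨0, by simp, by simp⟩

lemma l1Norm_pinv_mulVec_le (K : Matrix (Fin m) (Fin n) ℝ) (v : Fin m → ℝ) :
    l1Norm ((pinv K).mulVec v) ≤ pinvNorm K * √(sqNorm v) := by
  rcases (sqNorm_nonneg v).eq_or_lt with h | h
  · rw [eq_zero_of_sqNorm_eq_zero h.symm]; simp
  have hs : 0 < √(sqNorm v) := Real.sqrt_pos.2 h
  have := le_csSup (bddAbove_pinvNorm K)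
    ⟨(√(sqNorm v))⁻¹ • v, by rw [sqNorm_smul, inv_pow, Real.sq_sqrt h.le]; field_simp; rfl, rfl⟩
  rw [mulVec_smul, l1Norm_smul, abs_of_pos (inv_pos.2 hs), inv_mul_le_iff₀ hs] at this
  rw [mul_comm]; exact this

/-- The inverse Gram matrix factors as the pseudoinverse times its transpose. By duality the
transpose maps `ℓ∞` to `ℓ²` with the same norm bound, hence the square. -/
lemma l1Norm_inv_gram_mulVec_le (hK : IsUnit (K.transpose * K)) {g : Fin n → ℝ} {c : ℝ}
    (hc : 0 ≤ c) (hg : ∀ i, |g i| ≤ c) :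
    l1Norm ((K.transpose * K)⁻¹.mulVec g) ≤ pinvNorm K ^ 2 * c := by
  have key : ∀ {g : Fin n → ℝ} {c : ℝ}, 0 ≤ c → (∀ i, |g i| ≤ c) →
      √(sqNorm ((pinv K).transpose.mulVec g)) ≤ pinvNorm K * c := by
    intro g c hc hg
    set u := (pinv K).transpose.mulVec g with hu
    rcases (Real.sqrt_nonneg (sqNorm u)).eq_or_lt with h | h
    · rw [← h]; exact mul_nonneg (pinvNorm_nonneg K) hc
    -- Self-bounding: the squared norm of `u` is at most a constant times its norm, and one factor
    -- is cancelled afterwards.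
    have h1 : sqNorm u ≤ c * (pinvNorm K * √(sqNorm u)) := by
      have h2 : sqNorm u = g ⬝ᵥ (pinv K).mulVec u := by
        rw [sqNorm_eq_dotProduct, dotProduct_mulVec, ← mulVec_transpose, transpose_transpose,
          dotProduct_comm]
      rw [h2]
      refine (le_abs_self _).trans ((abs_dotProduct_le_mul_l1Norm hg _).trans ?_)
      rw [← h2]
      exact mul_le_mul_of_nonneg_left (l1Norm_pinv_mulVec_le K _) hc
    rw [← Real.mul_self_sqrt (sqNorm_nonneg u), ← mul_assoc] at h1
    rw [mul_comm]
    refine le_of_mul_le_mul_right ?_ h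
    rwa [Real.sqrt_mul_self (Real.sqrt_nonneg _)] at h1
  rw [← pinv_mul_transpose_pinv hK, ← mulVec_mulVec]
  refine (l1Norm_pinv_mulVec_le K _).trans ?_
  rw [sq, mul_assoc]
  exact mul_le_mul_of_nonneg_left (key hc hg) (pinvNorm_nonneg K)

end PseudoInverse

/-! ### Optimal plans on an interval of times -/

section Plans

variable {K : Matrix (Fin m) (Fin n) ℝ} {β : ℝ} {a b : ℕ} {q y : ℕ → Fin m → ℝ}
  {x : ℕ → Fin n → ℝ}

open Matrix

/-- The actions of `x` at the times `a, …, b` are optimal for the targets `q`, given the action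
of `x` at time `a - 1`. -/
def OptOn (K : Matrix (Fin m) (Fin n) ℝ) (β : ℝ) (a b : ℕ) (q : ℕ → Fin m → ℝ)
    (x : ℕ → Fin n → ℝ) : Prop :=
  ∀ x' : ℕ → Fin n → ℝ, x' (a - 1) = x (a - 1) → costOn K β a b q x ≤ costOn K β a b q x'

lemma costOn_nonneg (hβ : 0 ≤ β) (q : ℕ → Fin m → ℝ) (x : ℕ → Fin n → ℝ) :
    0 ≤ costOn K β a b q x :=
  Finset.sum_nonneg fun _ _ => add_nonneg (mul_nonneg (by norm_num) (sqNorm_nonneg _))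
    (mul_nonneg hβ (l1Norm_nonneg _))

lemma costOn_congr {q' : ℕ → Fin m → ℝ} {x' : ℕ → Fin n → ℝ}
    (hq : ∀ t ∈ Finset.Icc a b, q t = q' t) (hx : ∀ t, a - 1 ≤ t → t ≤ b → x t = x' t) :
    costOn K β a b q x = costOn K β a b q' x' := by
  refine Finset.sum_congr rfl fun t ht => ?_
  have ht' := Finset.mem_Icc.1 ht
  rw [hq t ht, hx t (by omega) (by omega), hx (t - 1) (by omega) (by omega)]

lemma costOn_add_costOn (q : ℕ → Fin m → ℝ) (x : ℕ → Fin n → ℝ) {c : ℕ} (hac : a ≤ c + 1)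
    (hcb : c ≤ b) :
    costOn K β a c q x + costOn K β (c + 1) b q x = costOn K β a b q x := by
  rw [costOn, costOn, costOn, ← Finset.sum_union]
  · congr 1
    ext t; simp only [Finset.mem_union, Finset.mem_Icc]; omega
  · rw [Finset.disjoint_left]
    intro t; simp only [Finset.mem_Icc]; omega

lemma continuous_costOn :
    Continuous fun z : (ℕ → Fin m → ℝ) × (ℕ → Fin n → ℝ) => costOn K β a b z.1 z.2 := by
  unfold costOn
  refine continuous_finsetSum _ fun t _ => ?_
  refine ((continuous_sqNorm.comp ?_).const_mul _).add ((continuous_l1Norm.comp ?_).const_mul _)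
  · exact ((continuous_apply t).comp continuous_fst).sub
      (Continuous.matrix_mulVec continuous_const ((continuous_apply t).comp continuous_snd))
  · exact ((continuous_apply t).comp continuous_snd).sub
      ((continuous_apply (t - 1)).comp continuous_snd)

lemma costOn_segment_le (hβ : 0 ≤ β) (q : ℕ → Fin m → ℝ) (x x' : ℕ → Fin n → ℝ) {θ : ℝ}
    (h0 : 0 ≤ θ) (h1 : θ ≤ 1) :
    costOn K β a b q ((1 - θ) • x + θ • x') ≤
      (1 - θ) * costOn K β a b q x + θ * costOn K β a b q x'
        - θ * (1 - θ) * (1 / 2 * ∑ t ∈ Finset.Icc a b, sqNorm (K.mulVec (x t - x' t))) := by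
  simp only [costOn, Finset.mul_sum]
  rw [← Finset.sum_add_distrib, ← Finset.sum_sub_distrib]
  refine Finset.sum_le_sum fun t _ => ?_
  have e1 : q t - K.mulVec (((1 - θ) • x + θ • x') t) =
      (1 - θ) • (q t - K.mulVec (x t)) + θ • (q t - K.mulVec (x' t)) := by
    simp only [Pi.add_apply, Pi.smul_apply, mulVec_add, mulVec_smul]
    module
  have e2 : ((1 - θ) • x + θ • x') t - ((1 - θ) • x + θ • x') (t - 1) =
      (1 - θ) • (x t - x (t - 1)) + θ • (x' t - x' (t - 1)) := by
    simp only [Pi.add_apply, Pi.smul_apply]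
    module
  have e3 : q t - K.mulVec (x t) - (q t - K.mulVec (x' t)) = -K.mulVec (x t - x' t) := by
    rw [mulVec_sub]; abel
  have e4 : l1Norm ((1 - θ) • (x t - x (t - 1)) + θ • (x' t - x' (t - 1))) ≤
      (1 - θ) * l1Norm (x t - x (t - 1)) + θ * l1Norm (x' t - x' (t - 1)) := by
    refine (l1Norm_add_le _ _).trans_eq ?_
    rw [l1Norm_smul, l1Norm_smul, abs_of_nonneg h0, abs_of_nonneg (by linarith)]
  have e5 := mul_le_mul_of_nonneg_left e4 hβ
  rw [e1, e2, sqNorm_segment, e3, sqNorm_neg]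
  linarith

lemma convexOn_costOn (hβ : 0 ≤ β) (q : ℕ → Fin m → ℝ) :
    ConvexOn ℝ Set.univ (fun x : ℕ → Fin n → ℝ => costOn K β a b q x) := by
  refine ⟨convex_univ, fun x _ x' _ s t hs ht hst => ?_⟩
  obtain rfl : s = 1 - t := by linarith
  refine (costOn_segment_le hβ q x x' ht (by linarith)).trans ?_
  have : 0 ≤ t * (1 - t) * (1 / 2 * ∑ t ∈ Finset.Icc a b, sqNorm (K.mulVec (x t - x' t))) :=
    mul_nonneg (mul_nonneg ht hs)
      (mul_nonneg (by norm_num) (Finset.sum_nonneg fun _ _ => sqNorm_nonneg _))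
  simp only [smul_eq_mul]
  linarith

/-- Quadratic growth at a minimizer: test optimality along the segment towards the competitor,
divide by `θ`, and let `θ` tend to `0`. -/
lemma OptOn.add_le (hβ : 0 ≤ β) (hx : OptOn K β a b q x) {x' : ℕ → Fin n → ℝ}
    (hx' : x' (a - 1) = x (a - 1)) :
    costOn K β a b q x + 1 / 2 * ∑ t ∈ Finset.Icc a b, sqNorm (K.mulVec (x t - x' t)) ≤
      costOn K β a b q x' := by
  set D := 1 / 2 * ∑ t ∈ Finset.Icc a b, sqNorm (K.mulVec (x t - x' t)) with hD
  have key : ∀ θ : ℝ, 0 < θ → θ ≤ 1 →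
      costOn K β a b q x + (1 - θ) * D ≤ costOn K β a b q x' := by
    intro θ h0 h1
    have h2 := hx ((1 - θ) • x + θ • x') (by simp [hx', ← add_smul])
    have h3 := h2.trans (costOn_segment_le hβ q x x' h0.le h1)
    rw [← hD] at h3
    refine le_of_mul_le_mul_left ?_ h0
    linarith
  have hlim : Tendsto (fun θ : ℝ => costOn K β a b q x + (1 - θ) * D) (nhdsWithin 0 (Set.Ioi 0))
      (nhds (costOn K β a b q x + (1 - 0) * D)) :=
    (Continuous.tendsto (by fun_prop) 0).mono_left nhdsWithin_le_nhds
  rw [sub_zero, one_mul] at hlim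
  refine le_of_tendsto hlim ?_
  filter_upwards [Ioc_mem_nhdsGT (zero_lt_one' ℝ)] with θ hθ using key θ hθ.1 hθ.2

/-- Changing the action before the interval changes the cost by at most the switching cost
between the old and the new action. -/
lemma costOn_update_le (ha : 1 ≤ a) (hβ : 0 ≤ β) (y : ℕ → Fin m → ℝ) (x : ℕ → Fin n → ℝ)
    (z : Fin n → ℝ) :
    costOn K β a b y (Function.update x (a - 1) z) ≤
      costOn K β a b y x + β * l1Norm (x (a - 1) - z) := by
  have h1 : ∑ t ∈ Finset.Icc a b, (if t = a then β * l1Norm (x (a - 1) - z) else 0) ≤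
      β * l1Norm (x (a - 1) - z) := by
    rw [Finset.sum_ite_eq']
    split_ifs
    · exact le_rfl
    · exact mul_nonneg hβ (l1Norm_nonneg _)
  refine le_trans ?_ (add_le_add_right h1 _)
  rw [costOn, costOn, ← Finset.sum_add_distrib]
  refine Finset.sum_le_sum fun t ht => ?_
  have ht' := Finset.mem_Icc.1 ht
  rw [Function.update_of_ne (by omega)]
  split_ifs with hta
  · subst hta
    have h2 := mul_le_mul_of_nonneg_left
      (l1Norm_add_le (x t - x (t - 1)) (x (t - 1) - z)) hβ
    rw [sub_add_sub_cancel] at h2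
    rw [Function.update_self]
    linarith
  · rw [Function.update_of_ne (by omega)]
    simp

/-- The cost of planning with the targets `q` when the realized targets are `y`. -/
lemma OptOn.costOn_le (hK : IsUnit (K.transpose * K)) (ha : 1 ≤ a) (hβ : 0 ≤ β)
    (hx : OptOn K β a b q x) (y : ℕ → Fin m → ℝ) (xs : ℕ → Fin n → ℝ) :
    costOn K β a b y x ≤ costOn K β a b y xs + β * l1Norm (xs (a - 1) - x (a - 1))
      + ∑ t ∈ Finset.Icc a b, 1 / 2 * sqNorm ((K * pinv K).mulVec (y t - q t)) := by
  -- The comparison sequence must share the initial action of `x` to be admissible; the splice costs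
  -- one switch.
  set x' := Function.update xs (a - 1) (x (a - 1)) with hx'
  have h1 := hx.add_le hβ (x' := x') (by simp [hx'])
  have h2 := costOn_update_le (K := K) (b := b) ha hβ y xs (x (a - 1))
  rw [← hx'] at h2
  -- Switching costs cancel and only the cross term between `y - q` and `K (x - x')` is left.
  -- Young's inequality with weights `1/2` exactly uses up the quadratic gain of `h1`.
  have h3 : costOn K β a b y x - costOn K β a b q x + costOn K β a b q x' - costOn K β a b y x'
      ≤ 1 / 2 * ∑ t ∈ Finset.Icc a b, sqNorm (K.mulVec (x t - x' t))
        + ∑ t ∈ Finset.Icc a b, 1 / 2 * sqNorm ((K * pinv K).mulVec (y t - q t)) := by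
    simp only [costOn, Finset.mul_sum]
    rw [← Finset.sum_sub_distrib, ← Finset.sum_add_distrib, ← Finset.sum_sub_distrib,
      ← Finset.sum_add_distrib]
    refine Finset.sum_le_sum fun t _ => ?_
    have e : ∀ z : Fin n → ℝ, y t - K.mulVec z = (q t - K.mulVec z) + (y t - q t) := by
      intro z; abel
    have h4 := dotProduct_le_half_sqNorm ((K * pinv K).mulVec (y t - q t))
      (-K.mulVec (x t - x' t))
    rw [sqNorm_neg, dotProduct_neg, ← dotProduct_mulVec_eq_proj hK, mulVec_sub,
      dotProduct_sub] at h4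
    rw [e, e, sqNorm_add, sqNorm_add, sub_dotProduct, sub_dotProduct, mulVec_sub,
      dotProduct_comm (K.mulVec (x t)), dotProduct_comm (K.mulVec (x' t))]
    linarith
  linarith

/-- Stability of optimal plans with respect to the targets and the initial action. -/
lemma OptOn.sum_sqNorm_le (ha : 1 ≤ a) (hβ : 0 ≤ β) {q' : ℕ → Fin m → ℝ}
    {x' : ℕ → Fin n → ℝ} (hx : OptOn K β a b q x) (hx' : OptOn K β a b q' x') :
    ∑ t ∈ Finset.Icc a b, sqNorm (K.mulVec (x t - x' t)) ≤
      ∑ t ∈ Finset.Icc a b, sqNorm (q t - q' t) + 4 * (β * l1Norm (x (a - 1) - x' (a - 1))) := by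
  -- Each plan is tested against the other with the initial action spliced in. Two splices, after
  -- half of the left side is absorbed, give the factor 4.
  have h1 := hx.add_le hβ (x' := Function.update x' (a - 1) (x (a - 1))) (by simp)
  have h2 := costOn_update_le (K := K) (b := b) ha hβ q x' (x (a - 1))
  have h3 := hx'.add_le hβ (x' := Function.update x (a - 1) (x' (a - 1))) (by simp)
  have h4 := costOn_update_le (K := K) (b := b) ha hβ q' x (x' (a - 1))
  have e1 : ∀ x x' : ℕ → Fin n → ℝ, ∑ t ∈ Finset.Icc a b,
      sqNorm (K.mulVec (x t - Function.update x' (a - 1) (x (a - 1)) t)) =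
      ∑ t ∈ Finset.Icc a b, sqNorm (K.mulVec (x t - x' t)) := by
    intro x x'
    refine Finset.sum_congr rfl fun t ht => ?_
    have := Finset.mem_Icc.1 ht
    rw [Function.update_of_ne (by omega)]
  have e2 : ∑ t ∈ Finset.Icc a b, sqNorm (K.mulVec (x' t - x t)) =
      ∑ t ∈ Finset.Icc a b, sqNorm (K.mulVec (x t - x' t)) :=
    Finset.sum_congr rfl fun t _ => by rw [mulVec_sub, sqNorm_sub_comm, ← mulVec_sub]
  rw [e1] at h1 h3
  rw [e2] at h3
  rw [l1Norm_sub_comm] at h2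
  have h5 : costOn K β a b q x' - costOn K β a b q' x' + costOn K β a b q' x - costOn K β a b q x
      ≤ 1 / 2 * ∑ t ∈ Finset.Icc a b, sqNorm (K.mulVec (x t - x' t))
        + 1 / 2 * ∑ t ∈ Finset.Icc a b, sqNorm (q t - q' t) := by
    simp only [costOn, Finset.mul_sum]
    rw [← Finset.sum_sub_distrib, ← Finset.sum_add_distrib, ← Finset.sum_sub_distrib,
      ← Finset.sum_add_distrib]
    refine Finset.sum_le_sum fun t _ => ?_
    have e : ∀ z : Fin n → ℝ, q t - K.mulVec z = (q' t - K.mulVec z) + (q t - q' t) := by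
      intro z; abel
    have h6 := dotProduct_le_half_sqNorm (q t - q' t) (K.mulVec (x t - x' t))
    rw [mulVec_sub, dotProduct_sub] at h6
    rw [e, e, sqNorm_add, sqNorm_add, sub_dotProduct, sub_dotProduct, mulVec_sub,
      dotProduct_comm (K.mulVec (x t)), dotProduct_comm (K.mulVec (x' t))]
    linarith
  linarith

/-- First-order optimality conditions: the gradient of the tracking cost is bounded. -/
lemma OptOn.abs_gradient_le (ha : 1 ≤ a) (hβ : 0 ≤ β) (hx : OptOn K β a b q x) {t : ℕ}
    (ht : t ∈ Finset.Icc a b) (i : Fin n) :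
    |K.transpose.mulVec (q t - K.mulVec (x t)) i| ≤ β * (if t < b then 2 else 1) := by
  have ht' := Finset.mem_Icc.1 ht
  set r := q t - K.mulVec (x t) with hr
  set c : ℝ := β * (if t < b then 2 else 1) with hc
  -- Moving only the action at `t` affects the switch into `t` and, unless `t = b`, the switch out
  -- of it; this is the factor 2 or 1 in `c`.
  have hquad : ∀ h : Fin n → ℝ,
      0 ≤ 1 / 2 * sqNorm (K.mulVec h) - r ⬝ᵥ K.mulVec h + c * l1Norm h := by
    intro h
    have h1 := hx (Function.update x t (x t + h)) (by rw [Function.update_of_ne (by omega)])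
    have h2 : costOn K β a b q (Function.update x t (x t + h)) ≤ costOn K β a b q x +
        (∑ s ∈ Finset.Icc a b, (if s = t then
          1 / 2 * sqNorm (K.mulVec h) - r ⬝ᵥ K.mulVec h + β * l1Norm h else 0) +
        ∑ s ∈ Finset.Icc a b, (if s = t + 1 then β * l1Norm h else 0)) := by
      rw [costOn, costOn, ← Finset.sum_add_distrib, ← Finset.sum_add_distrib]
      refine Finset.sum_le_sum fun s hs => ?_
      have hs' := Finset.mem_Icc.1 hs
      rcases eq_or_ne s t with rfl | hst
      · rw [Function.update_self, Function.update_of_ne (by omega), if_pos rfl,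
          if_neg (by omega), mulVec_add, ← sub_sub, ← hr, sqNorm_sub, add_sub_right_comm]
        have := mul_le_mul_of_nonneg_left (l1Norm_add_le (x s - x (s - 1)) h) hβ
        linarith
      · rw [Function.update_of_ne hst, if_neg hst]
        rcases eq_or_ne s (t + 1) with rfl | hst'
        · rw [if_pos rfl, Nat.add_sub_cancel, Function.update_self, ← sub_sub]
          have := mul_le_mul_of_nonneg_left (l1Norm_sub_le (x (t + 1) - x t) h) hβ
          linarith
        · rw [Function.update_of_ne (by omega), if_neg hst']
          simp
    rw [Finset.sum_ite_eq', if_pos ht, Finset.sum_ite_eq'] at h2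
    have h3 : (if t + 1 ∈ Finset.Icc a b then β * l1Norm h else 0) + β * l1Norm h
        = c * l1Norm h := by
      by_cases htb : t < b
      · rw [if_pos (Finset.mem_Icc.2 (by omega)), hc, if_pos htb]; ring
      · rw [if_neg (by rw [Finset.mem_Icc]; omega), hc, if_neg htb]; ring
    linarith
  -- Scaling `h` by `s` and letting `s` tend to `0` removes the quadratic term.
  have hlin : ∀ h : Fin n → ℝ, r ⬝ᵥ K.mulVec h ≤ c * l1Norm h := by
    intro h
    have key : ∀ s : ℝ, 0 < s → r ⬝ᵥ K.mulVec h ≤ c * l1Norm h + s * (1 / 2 * sqNorm (K.mulVec h)) := by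
      intro s hs
      have := hquad (s • h)
      rw [mulVec_smul, sqNorm_smul, dotProduct_smul, l1Norm_smul, abs_of_pos hs,
        smul_eq_mul] at this
      refine le_of_mul_le_mul_left ?_ hs
      linarith
    have hlim : Tendsto (fun s : ℝ => c * l1Norm h + s * (1 / 2 * sqNorm (K.mulVec h)))
        (nhdsWithin 0 (Set.Ioi 0)) (nhds (c * l1Norm h + 0 * (1 / 2 * sqNorm (K.mulVec h)))) :=
      (Continuous.tendsto (by fun_prop) 0).mono_left nhdsWithin_le_nhds
    rw [zero_mul, add_zero] at hlim
    exact ge_of_tendsto hlim (by filter_upwards [self_mem_nhdsWithin] with s hs using key s hs)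
  have hcoord : ∀ s : ℝ, |s| = 1 → s * K.transpose.mulVec r i ≤ c := by
    intro s hs
    have := hlin (Pi.single i s)
    rw [dotProduct_mulVec, ← mulVec_transpose, dotProduct_single] at this
    have hl : l1Norm (Pi.single i s : Fin n → ℝ) = 1 := by
      rw [l1Norm, Finset.sum_eq_single i]
      · simpa using hs
      · intro j _ hj; simp [hj]
      · simp
    rw [hl, mul_one] at this
    rwa [mul_comm]
  refine abs_le.2 ⟨?_, ?_⟩
  · have := hcoord (-1) (by simp); linarith
  · have := hcoord 1 (by simp); linarith

/-- Distance between an optimal plan for the targets `y` and the last action of an optimal plan for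
the targets `q`. -/
lemma OptOn.mul_l1Norm_sub_le (hK : IsUnit (K.transpose * K)) (ha : 1 ≤ a) (hab : a ≤ b)
    (hβ : 0 ≤ β) (hx : OptOn K β a b q x) {T : ℕ} {xs : ℕ → Fin n → ℝ}
    (hxs : OptOn K β 1 T y xs) (hbT : b ≤ T) :
    β * l1Norm (xs b - x b) ≤ constB K β * √(sqNorm (y b - q b)) + 3 * constB K β ^ 2 := by
  have h1 := hx.abs_gradient_le ha hβ (Finset.mem_Icc.2 ⟨hab, le_rfl⟩)
  have h2 := hxs.abs_gradient_le le_rfl hβ (Finset.mem_Icc.2 ⟨ha.trans hab, hbT⟩)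
  set g := K.transpose.mulVec (q b - K.mulVec (x b))
  set gs := K.transpose.mulVec (y b - K.mulVec (xs b))
  have e : xs b - x b = (pinv K).mulVec (y b - q b) - (K.transpose * K)⁻¹.mulVec (gs - g) := by
    conv_lhs => rw [eq_pinv_mulVec_sub hK (y b) (xs b), eq_pinv_mulVec_sub hK (q b) (x b)]
    rw [mulVec_sub (pinv K), mulVec_sub _ gs]; abel
  -- The time `b` ends the window of `x`, contributing `β`, but may be interior for `xs`,
  -- contributing up to `2β`.
  have h3 : ∀ i, |(gs - g) i| ≤ 3 * β := by
    intro i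
    have h4 := (abs_sub (gs i) (g i)).trans (add_le_add (h2 i) (h1 i))
    rw [if_neg (lt_irrefl b)] at h4
    refine h4.trans ?_
    split_ifs <;> linarith
  have h5 := l1Norm_inv_gram_mulVec_le hK (by positivity) h3
  have h6 := l1Norm_pinv_mulVec_le K (y b - q b)
  rw [e]
  refine (mul_le_mul_of_nonneg_left ((l1Norm_sub_le _ _).trans (add_le_add h6 h5)) hβ).trans_eq ?_
  rw [constB]; ring

/-- Optimal plans exist. -/
lemma exists_optOn (hK : IsUnit (K.transpose * K)) (ha : 1 ≤ a) (hβ : 0 ≤ β) (b : ℕ)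
    (q : ℕ → Fin m → ℝ) (z : Fin n → ℝ) : ∃ x, x (a - 1) = z ∧ OptOn K β a b q x := by
  set M := costOn K β a b q (fun _ => z) with hM
  have hM0 : 0 ≤ M := costOn_nonneg hβ _ _
  -- A plan costing at most `M` has squared residuals at most `2M`, so `‖K x_t‖² ≤ 2‖q_t‖² + 4M`.
  -- The summand `l1Norm z` keeps the constant plan in the ball.
  set r : ℕ → ℝ := fun t => l1Norm z + pinvNorm K * √(2 * sqNorm (q t) + 4 * M) with hr
  have hr0 : ∀ t, l1Norm z ≤ r t := fun t =>
    le_add_of_nonneg_right (mul_nonneg (pinvNorm_nonneg K) (Real.sqrt_nonneg _))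
  -- Freezing all actions outside the interval at `z` makes the search set a product of compact
  -- sets.
  set S : Set (ℕ → Fin n → ℝ) := Set.pi Set.univ fun t =>
    if t ∈ Finset.Icc a b then Metric.closedBall 0 (r t) else {z} with hS
  have hz : ∀ t, z ∈ Metric.closedBall (0 : Fin n → ℝ) (r t) := fun t => by
    rw [mem_closedBall_zero_iff, pi_norm_le_iff_of_nonneg ((l1Norm_nonneg z).trans (hr0 t))]
    exact fun i => (abs_apply_le_l1Norm z i).trans (hr0 t)
  have hScomp : IsCompact S := by
    refine isCompact_univ_pi fun t => ?_
    split_ifs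
    · exact isCompact_closedBall _ _
    · exact isCompact_singleton
  have hzS : (fun _ => z) ∈ S := by
    intro t _
    dsimp only
    split_ifs
    · exact hz t
    · rfl
  obtain ⟨x, hxS, hx⟩ := hScomp.exists_isMinOn ⟨_, hzS⟩
    ((continuous_costOn (K := K) (β := β) (a := a) (b := b)).comp
      (Continuous.prodMk_right q)).continuousOn
  have hxa : x (a - 1) = z := by
    have := hxS (a - 1) (Set.mem_univ _)
    dsimp only at this
    rwa [if_neg (by rw [Finset.mem_Icc]; omega)] at this
  refine ⟨x, hxa, fun x' hx' => ?_⟩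
  rw [hxa] at hx'
  rcases le_total (costOn K β a b q x') M with hle | hle
  · have hx'' : (fun t => if t ∈ Finset.Icc a b then x' t else z) ∈ S := by
      intro t _
      dsimp only
      split_ifs with ht
      · rw [mem_closedBall_zero_iff, pi_norm_le_iff_of_nonneg ((l1Norm_nonneg z).trans (hr0 t))]
        intro i
        refine (abs_apply_le_l1Norm _ i).trans ?_
        rw [← pinv_mulVec_mulVec hK (x' t)]
        refine (l1Norm_pinv_mulVec_le K _).trans (le_trans ?_
          (le_add_of_nonneg_left (l1Norm_nonneg z)))
        refine mul_le_mul_of_nonneg_left (Real.sqrt_le_sqrt ?_) (pinvNorm_nonneg K)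
        have h1 : 1 / 2 * sqNorm (q t - K.mulVec (x' t)) ≤ costOn K β a b q x' := by
          refine le_trans (le_add_of_nonneg_right (mul_nonneg hβ (l1Norm_nonneg _)))
            (Finset.single_le_sum (f := fun t => (1 / 2 : ℝ) * sqNorm (q t - K.mulVec (x' t))
              + β * l1Norm (x' t - x' (t - 1))) (fun s _ => ?_) ht)
          exact add_nonneg (mul_nonneg (by norm_num) (sqNorm_nonneg _))
            (mul_nonneg hβ (l1Norm_nonneg _))
        have h2 := sqNorm_sub_le (q t) (q t - K.mulVec (x' t))
        rw [sub_sub_cancel] at h2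
        linarith
      · rfl
    refine (hx hx'').trans_eq (costOn_congr (fun _ _ => rfl) fun t ht1 ht2 => ?_)
    dsimp only
    split_ifs with h
    · rfl
    · rw [Finset.mem_Icc] at h
      obtain rfl : t = a - 1 := by omega
      exact hx'.symm
  · exact (hx hzS).trans hle

end Plans

/-! ### The windows of Fixed Horizon Control -/

/-- The number of planned times before `c` in the window of the `k`-th Fixed Horizon Control
algorithm that contains the time `c`. -/
def windowPos (w k c : ℕ) : ℕ := (c + (w + 1) - k) % (w + 1)

/-- The last time before the window that contains the time `c`. -/
def lastEnd (w k c : ℕ) : ℕ := c - 1 - windowPos w k c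

section Windows

variable {w k : ℕ}

lemma windowPos_le (w k c : ℕ) : windowPos w k c ≤ w :=
  Nat.lt_succ_iff.1 (Nat.mod_lt _ w.succ_pos)

lemma windowPos_sub (hk : k ≤ w) {c s : ℕ} (hs : s ≤ windowPos w k c) (hsc : s ≤ c) :
    windowPos w k (c - s) = windowPos w k c - s := by
  have h1 := Nat.mod_add_div (c + (w + 1) - k) (w + 1)
  have h2 := windowPos_le w k c
  unfold windowPos at *
  generalize (c + (w + 1) - k) % (w + 1) = r at *
  have h3 : c - s + (w + 1) - k = (r - s) + (w + 1) * ((c + (w + 1) - k) / (w + 1)) := by omega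
  rw [h3, Nat.add_mul_mod_self_left, Nat.mod_eq_of_lt (by omega)]

lemma windowPos_eq_of_succ (hk : k ≤ w) {c : ℕ} (h : windowPos w k (c + 1) = 0) :
    windowPos w k c = w := by
  by_contra hne
  have h1 := Nat.mod_add_div (c + (w + 1) - k) (w + 1)
  have h2 := windowPos_le w k c
  unfold windowPos at *
  generalize (c + (w + 1) - k) % (w + 1) = r at *
  have h3 : c + 1 + (w + 1) - k = (r + 1) + (w + 1) * ((c + (w + 1) - k) / (w + 1)) := by omega
  rw [h3, Nat.add_mul_mod_self_left, Nat.mod_eq_of_lt (by omega)] at h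
  omega

lemma lastEnd_lt {c : ℕ} (hc : 1 ≤ c) : lastEnd w k c < c := by
  unfold lastEnd; omega

lemma sub_lastEnd_le (c : ℕ) : c - lastEnd w k c ≤ windowPos w k c + 1 := by
  unfold lastEnd; omega

lemma lastEnd_eq_of_mem (hk : k ≤ w) {c t : ℕ} (h1 : lastEnd w k c < t) (h2 : t ≤ c) :
    lastEnd w k t = lastEnd w k c := by
  have h3 : c - t ≤ windowPos w k c := by unfold lastEnd at h1; omega
  have h4 := windowPos_sub hk h3 (Nat.sub_le _ _)
  rw [Nat.sub_sub_self h2] at h4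
  unfold lastEnd at *
  omega

/-- Truncated subtraction sends a first, possibly incomplete, window to the end point `0`. Every
other value is itself the end of a window, which lets the inductions below jump from window to
window. -/
lemma lastEnd_eq_zero_or (hk : k ≤ w) (c : ℕ) :
    lastEnd w k c = 0 ∨ windowPos w k (lastEnd w k c + 1) = 0 := by
  rcases Nat.eq_zero_or_pos (lastEnd w k c) with h | h
  · exact Or.inl h
  right
  have h1 : lastEnd w k c + 1 = c - windowPos w k c := by unfold lastEnd at *; omega
  rw [h1, windowPos_sub hk le_rfl (by unfold lastEnd at h; omega), Nat.sub_self]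

lemma lastEnd_of_windowPos {c : ℕ} (h : windowPos w k (c + 1) = 0) :
    lastEnd w k (c + 1) = c := by
  unfold lastEnd; omega

/-- For fixed `t` the map sending `k` to the position of `t` is an involution of `{0, …, w}`. -/
lemma sum_windowPos (w t : ℕ) (g : ℕ → ℝ) :
    ∑ k ∈ Finset.range (w + 1), g (windowPos w k t) = ∑ d ∈ Finset.range (w + 1), g d := by
  have key : ∀ k ≤ w, windowPos w (windowPos w k t) t = k := by
    intro k hk
    have h1 := Nat.mod_add_div (t + (w + 1) - k) (w + 1)
    have h2 := windowPos_le w k t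
    unfold windowPos at *
    generalize (t + (w + 1) - k) % (w + 1) = r at *
    have h3 : t + (w + 1) - r = k + (w + 1) * ((t + (w + 1) - k) / (w + 1)) := by omega
    rw [h3, Nat.add_mul_mod_self_left, Nat.mod_eq_of_lt (by omega)]
  refine Finset.sum_bij' (fun k _ => windowPos w k t) (fun k _ => windowPos w k t)
    ?_ ?_ ?_ ?_ fun _ _ => rfl
  · exact fun k _ => Finset.mem_range_succ_iff.2 (windowPos_le _ _ _)
  · exact fun k _ => Finset.mem_range_succ_iff.2 (windowPos_le _ _ _)
  · exact fun k hk => key k (Finset.mem_range_succ_iff.1 hk)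
  · exact fun k hk => key k (Finset.mem_range_succ_iff.1 hk)

lemma exists_windowPos_eq (hk : k ≤ w) (c : ℕ) :
    ∃ j : ℤ, (c : ℤ) - windowPos w k c = k + (w + 1) * j := by
  have h1 := Nat.mod_add_div (c + (w + 1) - k) (w + 1)
  rw [← windowPos] at h1
  refine ⟨((c + (w + 1) - k) / (w + 1) : ℕ) - 1, ?_⟩
  have h2 : ((windowPos w k c + (w + 1) * ((c + (w + 1) - k) / (w + 1)) : ℕ) : ℤ)
      = ((c + (w + 1) - k : ℕ) : ℤ) := congrArg _ h1
  rw [Nat.cast_sub (by omega)] at h2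
  push_cast at h2 ⊢
  linarith

lemma windowPos_eq_of_modEq (hk : k ≤ w) {c : ℕ} {τ : ℤ} (h : τ ≡ k [ZMOD (w + 1)])
    (h1 : τ ≤ c) (h2 : (c : ℤ) ≤ τ + w) : (windowPos w k c : ℤ) = c - τ := by
  obtain ⟨j, hj⟩ := exists_windowPos_eq hk c
  have h3 := windowPos_le w k c
  obtain ⟨i, hi⟩ := h.dvd
  -- Both numbers lie in `[0, w]`, so congruence modulo `w + 1` is equality.
  have h4 : (w + 1 : ℤ) ∣ (windowPos w k c : ℤ) - (c - τ) := ⟨-(i + j), by linarith⟩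
  have h5 := Int.eq_zero_of_abs_lt_dvd h4 (by rw [abs_lt]; omega)
  omega

end Windows

/-! ### Runs of Fixed Horizon Control: existence, cost, continuity in the predictions. -/

section FHC

variable {K : Matrix (Fin m) (Fin n) ℝ} {β : ℝ} {T w k : ℕ} {p : ℕ → ℕ → Fin m → ℝ}
  {x : ℕ → Fin n → ℝ}

/-- A run of Fixed Horizon Control is optimal on all its windows, which end at the times `c`. -/
lemma isFHC_iff (hk : k ≤ w) : IsFHC K β T w k p x ↔ x 0 = 0 ∧ ∀ c ∈ Finset.Icc 1 T,
    (c = T ∨ windowPos w k (c + 1) = 0) →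
      OptOn K β (lastEnd w k c + 1) c (p (lastEnd w k c)) x := by
  refine and_congr_right fun _ => ⟨fun h c hc hend => ?_, fun h τ hτ1 hτ2 hτ a b ha hb => ?_⟩
  · rw [Finset.mem_Icc] at hc
    have h1 := windowPos_le w k c
    have h2 : c = T ∨ windowPos w k c = w := hend.imp_right (windowPos_eq_of_succ hk)
    obtain ⟨j, hj⟩ := exists_windowPos_eq hk c
    have := h ((c : ℤ) - windowPos w k c) (by omega) (by omega)
      (by rw [hj]; exact Int.add_mul_emod_self_left _ _ _)
      (lastEnd w k c + 1) c (by unfold lastEnd; omega) (by omega)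
    rwa [Nat.add_sub_cancel] at this
  · rcases lt_or_ge b a with hab | hab
    · intro x' _
      rw [costOn, costOn, Finset.Icc_eq_empty (by omega), Finset.sum_empty, Finset.sum_empty]
    have hpos := windowPos_eq_of_modEq (c := b) hk hτ (by omega) (by omega)
    have hlast : lastEnd w k b + 1 = a := by unfold lastEnd; omega
    have hend : b = T ∨ windowPos w k (b + 1) = 0 := by
      by_cases hbT : b = T
      · exact Or.inl hbT
      right
      have h1 : τ + (w + 1) ≡ k [ZMOD (w + 1)] := (Int.add_emod_right _ _).trans hτ
      have := windowPos_eq_of_modEq (c := b + 1) hk h1 (by push_cast; omega) (by push_cast; omega)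
      push_cast at this
      omega
    have := h b (Finset.mem_Icc.2 (by omega)) hend
    rw [hlast, show lastEnd w k b = a - 1 by omega] at this
    exact this

lemma OptOn.congr {a b : ℕ} {q : ℕ → Fin m → ℝ} {x' : ℕ → Fin n → ℝ} (hx : OptOn K β a b q x)
    (hab : a - 1 ≤ b) (h : ∀ t, a - 1 ≤ t → t ≤ b → x t = x' t) : OptOn K β a b q x' := by
  intro z hz
  rw [← costOn_congr (fun _ _ => rfl) h]
  exact hx z (by rw [hz, h _ le_rfl hab])

/-- Induction over the window ends: an optimal plan for the last window is glued to a run up to the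
preceding end. -/
lemma exists_isFHC (hK : IsUnit (K.transpose * K)) (hβ : 0 ≤ β) (hk : k ≤ w)
    (p : ℕ → ℕ → Fin m → ℝ) : ∃ x, IsFHC K β T w k p x := by
  simp_rw [isFHC_iff hk]
  suffices h : ∀ b ≤ T, (b = 0 ∨ b = T ∨ windowPos w k (b + 1) = 0) →
      ∃ x : ℕ → Fin n → ℝ, x 0 = 0 ∧ ∀ c ∈ Finset.Icc 1 b, (c = T ∨ windowPos w k (c + 1) = 0) →
        OptOn K β (lastEnd w k c + 1) c (p (lastEnd w k c)) x from
    h T le_rfl (Or.inr (Or.inl rfl))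
  intro b
  induction b using Nat.strong_induction_on with
  | _ b ih =>
    intro hbT _
    rcases Nat.eq_zero_or_pos b with rfl | hb0
    · exact ⟨0, rfl, fun c hc => by simp at hc⟩
    have hlt := lastEnd_lt (w := w) (k := k) hb0
    obtain ⟨x, hx0, hx⟩ := ih _ hlt (hlt.le.trans hbT)
      ((lastEnd_eq_zero_or hk b).imp_right Or.inr)
    obtain ⟨z, hz1, hz⟩ := exists_optOn hK (Nat.succ_pos (lastEnd w k b)) hβ b
      (p (lastEnd w k b)) (x (lastEnd w k b))
    rw [Nat.succ_sub_one] at hz1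
    refine ⟨fun t => if t ≤ lastEnd w k b then x t else z t, by simpa using hx0,
      fun c hc hend => ?_⟩
    rw [Finset.mem_Icc] at hc
    rcases le_or_gt c (lastEnd w k b) with hcb | hcb
    · refine (hx c (Finset.mem_Icc.2 ⟨hc.1, hcb⟩) hend).congr
        (by rw [Nat.add_sub_cancel]; exact (lastEnd_lt hc.1).le) fun t _ ht2 => ?_
      rw [if_pos (ht2.trans hcb)]
    -- No window ends strictly inside the last one: the next time would otherwise have two different
    -- values of `lastEnd`.
    · obtain rfl : c = b := by
        by_contra hne
        have h1 : windowPos w k (c + 1) = 0 := hend.resolve_left (by omega)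
        have h2 := lastEnd_of_windowPos h1
        rw [lastEnd_eq_of_mem hk (c := b) (by omega) (by omega)] at h2
        omega
      refine hz.congr (by simpa using hlt.le) fun t ht1 _ => ?_
      split_ifs with ht
      · obtain rfl : t = lastEnd w k c := by simp at ht1; omega
        exact hz1
      · rfl

lemma fhc_zero (hK : IsUnit (K.transpose * K)) (hβ : 0 ≤ β) (hk : k ≤ w)
    (p : ℕ → ℕ → Fin m → ℝ) : fhc K β T w k p 0 = 0 :=
  (Classical.epsilon_spec (exists_isFHC hK hβ hk p)).1

lemma fhc_optOn (hK : IsUnit (K.transpose * K)) (hβ : 0 ≤ β) (hk : k ≤ w)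
    (p : ℕ → ℕ → Fin m → ℝ) {c : ℕ} (hc : c ∈ Finset.Icc 1 T)
    (hend : c = T ∨ windowPos w k (c + 1) = 0) :
    OptOn K β (lastEnd w k c + 1) c (p (lastEnd w k c)) (fhc K β T w k p) :=
  ((isFHC_iff hk).1 (Classical.epsilon_spec (exists_isFHC hK hβ hk p))).2 c hc hend

/-- The cost of Fixed Horizon Control compared with the dynamic optimum `xs`. -/
lemma cost_fhc_le (hK : IsUnit (K.transpose * K)) (hβ : 0 ≤ β) (hk : k ≤ w)
    (p : ℕ → ℕ → Fin m → ℝ) (y : ℕ → Fin m → ℝ) {xs : ℕ → Fin n → ℝ} (hxs0 : xs 0 = 0)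
    (hxs : OptOn K β 1 T y xs) :
    cost K β T y (fhc K β T w k p) ≤ cost K β T y xs + ∑ t ∈ Finset.Icc 1 T,
      (1 / 2 * sqNorm ((K * pinv K).mulVec (y t - p (lastEnd w k t) t)) +
        if 2 ≤ t ∧ windowPos w k t = 0 then
          constB K β * √(sqNorm (y (t - 1) - p (lastEnd w k (t - 1)) (t - 1)))
            + 3 * constB K β ^ 2
        else 0) := by
  set x := fhc K β T w k p with hx
  -- The restart cost of a window is booked at its first time `t`, using the prediction error at the
  -- end `t - 1` of the window before. For `t = 1` there is none, since both sequences start at `0`.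
  set g : ℕ → ℝ := fun t => if 2 ≤ t ∧ windowPos w k t = 0 then
    constB K β * √(sqNorm (y (t - 1) - p (lastEnd w k (t - 1)) (t - 1))) + 3 * constB K β ^ 2
    else 0 with hg
  have hB : 0 ≤ constB K β := mul_nonneg hβ (pinvNorm_nonneg K)
  have hg0 : ∀ t, 0 ≤ g t := by
    intro t; simp only [hg]; split_ifs <;> positivity
  suffices h : ∀ b ≤ T, (b = 0 ∨ b = T ∨ windowPos w k (b + 1) = 0) →
      costOn K β 1 b y x ≤ costOn K β 1 b y xs + ∑ t ∈ Finset.Icc 1 b,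
        (1 / 2 * sqNorm ((K * pinv K).mulVec (y t - p (lastEnd w k t) t)) + g t) from
    h T le_rfl (Or.inr (Or.inl rfl))
  intro b
  induction b using Nat.strong_induction_on with
  | _ b ih =>
    intro hbT hb
    rcases Nat.eq_zero_or_pos b with rfl | hb0
    · simp [costOn]
    have hlt := lastEnd_lt (w := w) (k := k) hb0
    have hNend := lastEnd_eq_zero_or (w := w) hk b
    have ih' := ih _ hlt (hlt.le.trans hbT) (hNend.imp_right Or.inr)
    have hopt := fhc_optOn (T := T) hK hβ hk p (Finset.mem_Icc.2 ⟨hb0, hbT⟩)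
      (hb.resolve_left hb0.ne')
    rw [← hx] at hopt
    have hmem : ∀ t ∈ Finset.Icc (lastEnd w k b + 1) b, lastEnd w k t = lastEnd w k b := by
      intro t ht
      rw [Finset.mem_Icc] at ht
      exact lastEnd_eq_of_mem hk (by omega) ht.2
    have h1 := hopt.costOn_le hK (Nat.le_add_left 1 _) hβ y xs
    rw [Nat.add_sub_cancel] at h1
    set N := lastEnd w k b with hN
    have h2 : β * l1Norm (xs N - x N) ≤ ∑ t ∈ Finset.Icc (N + 1) b, g t := by
      rcases Nat.eq_zero_or_pos N with hN0 | hN0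
      · rw [hN0, hxs0, hx, fhc_zero hK hβ hk, sub_zero, l1Norm_zero, mul_zero]
        exact Finset.sum_nonneg fun t _ => hg0 t
      have h3 : windowPos w k (N + 1) = 0 := hNend.resolve_left hN0.ne'
      have h4 := fhc_optOn (T := T) hK hβ hk p (Finset.mem_Icc.2 ⟨hN0, hlt.le.trans hbT⟩)
        (Or.inr h3)
      have h5 := h4.mul_l1Norm_sub_le hK (Nat.le_add_left 1 _) (lastEnd_lt hN0) hβ hxs
        (hlt.le.trans hbT)
      refine le_trans h5 (le_trans (le_of_eq ?_) (Finset.single_le_sum (fun t _ => hg0 t)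
        (Finset.mem_Icc.2 ⟨le_rfl, hlt⟩)))
      simp only [hg]
      rw [if_pos ⟨by omega, h3⟩, Nat.add_sub_cancel]
    have h6 : ∑ t ∈ Finset.Icc 1 b,
        (1 / 2 * sqNorm ((K * pinv K).mulVec (y t - p (lastEnd w k t) t)) + g t) =
        ∑ t ∈ Finset.Icc 1 N,
          (1 / 2 * sqNorm ((K * pinv K).mulVec (y t - p (lastEnd w k t) t)) + g t) +
        (∑ t ∈ Finset.Icc (N + 1) b,
          1 / 2 * sqNorm ((K * pinv K).mulVec (y t - p N t)) +
          ∑ t ∈ Finset.Icc (N + 1) b, g t) := by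
      rw [← Finset.sum_add_distrib]
      have h7 : Finset.Icc 1 b = Finset.Icc 1 N ∪ Finset.Icc (N + 1) b := by
        ext t; simp only [Finset.mem_union, Finset.mem_Icc]; omega
      rw [h7, Finset.sum_union]
      · congr 1
        exact Finset.sum_congr rfl fun t ht => by rw [hmem t ht]
      · rw [Finset.disjoint_left]
        intro t; simp only [Finset.mem_Icc]; omega
    rw [h6, ← costOn_add_costOn y x (c := N) (by omega) hlt.le,
      ← costOn_add_costOn y xs (c := N) (by omega) hlt.le]
    linarith

/-- The actions of Fixed Horizon Control depend continuously on the predictions. -/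
lemma continuous_fhc {X : Type*} [TopologicalSpace X] (hK : IsUnit (K.transpose * K))
    (hβ : 0 ≤ β) (hk : k ≤ w) {p : X → ℕ → ℕ → Fin m → ℝ}
    (hp : ∀ τ t, Continuous fun e => p e τ t) {t : ℕ} (ht : t ≤ T) :
    Continuous fun e => fhc K β T w k (p e) t := by
  suffices h : ∀ b ≤ T, (b = 0 ∨ b = T ∨ windowPos w k (b + 1) = 0) →
      ∀ t ≤ b, Continuous fun e => fhc K β T w k (p e) t from
    h T le_rfl (Or.inr (Or.inl rfl)) t ht
  intro b
  induction b using Nat.strong_induction_on with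
  | _ b ih =>
    intro hbT hb t htb
    rcases Nat.eq_zero_or_pos b with rfl | hb0
    · obtain rfl : t = 0 := by omega
      simp only [fhc_zero hK hβ hk]
      exact continuous_const
    have hlt := lastEnd_lt (w := w) (k := k) hb0
    have ih' := ih _ hlt (hlt.le.trans hbT) ((lastEnd_eq_zero_or hk b).imp_right Or.inr)
    rcases le_or_gt t (lastEnd w k b) with htN | htN
    · exact ih' t htN
    set N := lastEnd w k b with hN
    refine continuous_iff_continuousAt.2 fun e₀ => ?_
    -- The right-hand side of the stability estimate `OptOn.sum_sqNorm_le`: continuous by the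
    -- induction hypothesis at `N`, and zero at `e₀`.
    set ρ : X → ℝ := fun e => ∑ s ∈ Finset.Icc (N + 1) b, sqNorm (p e N s - p e₀ N s) +
      4 * (β * l1Norm (fhc K β T w k (p e) N - fhc K β T w k (p e₀) N)) with hρ
    have hρc : Continuous ρ := by
      refine (continuous_finsetSum _ fun s _ => ?_).add (((continuous_l1Norm.comp ?_).const_mul
        β).const_mul 4)
      · exact continuous_sqNorm.comp ((hp N s).sub continuous_const)
      · exact (ih' N le_rfl).sub continuous_const
    have hρ0 : ρ e₀ = 0 := by simp [hρ]
    have hbound : ∀ e i, |fhc K β T w k (p e) t i - fhc K β T w k (p e₀) t i| ≤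
        pinvNorm K * √(ρ e) := by
      intro e i
      have h1 := (fhc_optOn (T := T) hK hβ hk (p e) (Finset.mem_Icc.2 ⟨hb0, hbT⟩)
        (hb.resolve_left hb0.ne')).sum_sqNorm_le (Nat.le_add_left 1 _) hβ
        (fhc_optOn (T := T) hK hβ hk (p e₀) (Finset.mem_Icc.2 ⟨hb0, hbT⟩)
        (hb.resolve_left hb0.ne'))
      rw [Nat.add_sub_cancel] at h1
      have h2 := (Finset.single_le_sum (f := fun t => sqNorm (K.mulVec
        (fhc K β T w k (p e) t - fhc K β T w k (p e₀) t))) (fun _ _ => sqNorm_nonneg _)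
        (Finset.mem_Icc.2 ⟨htN, htb⟩)).trans h1
      refine (abs_apply_le_l1Norm (fhc K β T w k (p e) t - fhc K β T w k (p e₀) t) i).trans ?_
      rw [← pinv_mulVec_mulVec hK (fhc K β T w k (p e) t - fhc K β T w k (p e₀) t)]
      exact (l1Norm_pinv_mulVec_le K _).trans
        (mul_le_mul_of_nonneg_left (Real.sqrt_le_sqrt h2) (pinvNorm_nonneg K))
    refine continuousAt_pi.2 fun i => tendsto_iff_dist_tendsto_zero.2 ?_
    have hlim : Tendsto (fun e => pinvNorm K * √(ρ e)) (nhds e₀) (nhds 0) := by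
      have := (hρc.sqrt.const_mul (pinvNorm K)).tendsto e₀
      rwa [hρ0, Real.sqrt_zero, mul_zero] at this
    exact squeeze_zero (fun _ => dist_nonneg) (fun e => (Real.dist_eq _ _).trans_le (hbound e i))
      hlim

/-- The cost of Averaging Fixed Horizon Control is at most the average of the costs of the
Fixed Horizon Control algorithms. -/
lemma cost_afhcAction_le (hβ : 0 ≤ β) (y : ℕ → Fin m → ℝ) :
    cost K β T y (afhcAction K β T w p) ≤
      1 / ((w : ℝ) + 1) * ∑ k ∈ Finset.range (w + 1), cost K β T y (fhc K β T w k p) := by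
  have hw : (0 : ℝ) < w + 1 := by positivity
  have h := (convexOn_costOn (K := K) (a := 1) (b := T) hβ y).map_sum_le
    (t := Finset.range (w + 1)) (w := fun _ => 1 / ((w : ℝ) + 1))
    (p := fun k => fhc K β T w k p) (fun _ _ => by positivity)
    (by simp [Finset.sum_const, hw.ne']) (fun _ _ => Set.mem_univ _)
  have e : afhcAction K β T w p = ∑ k ∈ Finset.range (w + 1),
      (1 / ((w : ℝ) + 1)) • fhc K β T w k p := by
    ext t i
    simp [afhcAction, Finset.mul_sum]
  rw [e, Finset.mul_sum]
  exact h

end FHC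

/-! ### The offline optima -/

section Offline

variable {K : Matrix (Fin m) (Fin n) ℝ} {β : ℝ} {T : ℕ}

open Matrix

lemma bddBelow_cost (hβ : 0 ≤ β) (y : ℕ → Fin m → ℝ) :
    BddBelow (Set.range fun x : {x : ℕ → Fin n → ℝ // x 0 = 0} => cost K β T y x.1) :=
  ⟨0, by rintro _ ⟨x, rfl⟩; exact costOn_nonneg hβ _ _⟩

lemma optCost_le_cost (hβ : 0 ≤ β) (y : ℕ → Fin m → ℝ) {x : ℕ → Fin n → ℝ} (hx : x 0 = 0) :
    optCost K β T y ≤ cost K β T y x :=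
  ciInf_le (bddBelow_cost hβ y) ⟨x, hx⟩

lemma optCost_nonneg (hβ : 0 ≤ β) (y : ℕ → Fin m → ℝ) : 0 ≤ optCost K β T y :=
  Real.iInf_nonneg fun _ => costOn_nonneg hβ _ _

lemma le_optCost {y : ℕ → Fin m → ℝ} {c : ℝ}
    (h : ∀ x : ℕ → Fin n → ℝ, x 0 = 0 → c ≤ cost K β T y x) : c ≤ optCost K β T y := by
  have : Nonempty {x : ℕ → Fin n → ℝ // x 0 = 0} := ⟨⟨0, rfl⟩⟩
  exact le_ciInf fun x => h x.1 x.2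

lemma exists_cost_eq_optCost (hK : IsUnit (K.transpose * K)) (hβ : 0 ≤ β)
    (y : ℕ → Fin m → ℝ) : ∃ x : ℕ → Fin n → ℝ, x 0 = 0 ∧ OptOn K β 1 T y x ∧
      cost K β T y x = optCost K β T y := by
  obtain ⟨x, hx0, hx⟩ := exists_optOn hK le_rfl hβ T y 0
  refine ⟨x, hx0, hx, le_antisymm (le_optCost fun x' hx' => hx x' ?_)
    (optCost_le_cost hβ y hx0)⟩
  rw [Nat.sub_self] at hx0 ⊢
  rw [hx0, hx']

lemma bddBelow_static (hβ : 0 ≤ β) (y : ℕ → Fin m → ℝ) :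
    BddBelow (Set.range fun x : Fin n → ℝ =>
      (∑ t ∈ Finset.Icc 1 T, (1 / 2 : ℝ) * sqNorm (y t - K.mulVec x)) + β * l1Norm x) :=
  ⟨0, by
    rintro _ ⟨x, rfl⟩
    exact add_nonneg (Finset.sum_nonneg fun _ _ => mul_nonneg (by norm_num) (sqNorm_nonneg _))
      (mul_nonneg hβ (l1Norm_nonneg _))⟩

lemma staCost_nonneg (hβ : 0 ≤ β) (y : ℕ → Fin m → ℝ) : 0 ≤ staCost K β T y :=
  Real.iInf_nonneg fun _ =>
    add_nonneg (Finset.sum_nonneg fun _ _ => mul_nonneg (by norm_num) (sqNorm_nonneg _))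
      (mul_nonneg hβ (l1Norm_nonneg _))

lemma optCost_le_half_sum (hβ : 0 ≤ β) (y : ℕ → Fin m → ℝ) :
    optCost K β T y ≤ ∑ t ∈ Finset.Icc 1 T, (1 / 2 : ℝ) * sqNorm (y t) := by
  refine (optCost_le_cost hβ y (x := 0) rfl).trans_eq ?_
  simp [cost, costOn]

lemma staCost_le_half_sum (hβ : 0 ≤ β) (y : ℕ → Fin m → ℝ) :
    staCost K β T y ≤ ∑ t ∈ Finset.Icc 1 T, (1 / 2 : ℝ) * sqNorm (y t) := by
  refine (ciInf_le (bddBelow_static hβ y) 0).trans_eq ?_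
  simp

/-- The infimum runs over an uncountable set, but an infimum of continuous functions is upper
semicontinuous. -/
lemma measurable_optCost (hβ : 0 ≤ β) : Measurable (optCost K β T) := by
  refine UpperSemicontinuous.measurable (upperSemicontinuous_ciInf (fun y => bddBelow_cost hβ y)
    fun x => Continuous.upperSemicontinuous ?_)
  exact (continuous_costOn (K := K) (β := β) (a := 1) (b := T)).comp
    (f := fun y => (y, x.1)) (continuous_id.prodMk continuous_const)

lemma measurable_staCost (hβ : 0 ≤ β) : Measurable (staCost K β T) := by
  refine UpperSemicontinuous.measurable (upperSemicontinuous_ciInf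
    (fun y => bddBelow_static hβ y) fun x => Continuous.upperSemicontinuous ?_)
  refine (continuous_finsetSum _ fun t _ => (continuous_sqNorm.comp ?_).const_mul _).add
    continuous_const
  exact (continuous_apply t).sub continuous_const

/-- The cost of Averaging Fixed Horizon Control compared with the dynamic optimum. -/
lemma cost_afhcAction_le_optCost_add (hK : IsUnit (K.transpose * K)) (hβ : 0 ≤ β) (w : ℕ)
    (p : ℕ → ℕ → Fin m → ℝ) (y : ℕ → Fin m → ℝ) :
    cost K β T y (afhcAction K β T w p) ≤ optCost K β T y + 1 / ((w : ℝ) + 1) *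
      ∑ t ∈ Finset.Icc 1 T, ∑ k ∈ Finset.range (w + 1),
      (1 / 2 * sqNorm ((K * pinv K).mulVec (y t - p (lastEnd w k t) t)) +
        if 2 ≤ t ∧ windowPos w k t = 0 then
          constB K β * √(sqNorm (y (t - 1) - p (lastEnd w k (t - 1)) (t - 1)))
            + 3 * constB K β ^ 2
        else 0) := by
  obtain ⟨xs, hxs0, hxs, hopt⟩ := exists_cost_eq_optCost (T := T) hK hβ y
  have hw : (0 : ℝ) < w + 1 := by positivity
  refine (cost_afhcAction_le hβ y).trans ?_
  rw [Finset.sum_comm]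
  have h := Finset.sum_le_sum fun k (hk : k ∈ Finset.range (w + 1)) =>
    cost_fhc_le hK hβ (Finset.mem_range_succ_iff.1 hk) p y hxs0 hxs
  rw [Finset.sum_add_distrib, Finset.sum_const, Finset.card_range, nsmul_eq_mul, hopt] at h
  refine (mul_le_mul_of_nonneg_left h (by positivity)).trans_eq ?_
  rw [mul_add, ← mul_assoc, Nat.cast_add, Nat.cast_one, one_div_mul_cancel hw.ne', one_mul]

/-- Bounds the sum of the terms at `t - 1` by the sum of the terms at `t` when `g 0 = 0` and `0 ≤ g
T`. -/
lemma sum_pred_add_apply (g : ℕ → ℝ) (T : ℕ) :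
    ∑ t ∈ Finset.Icc 1 T, g (t - 1) + g T = ∑ t ∈ Finset.Icc 1 T, g t + g 0 := by
  induction T with
  | zero => simp
  | succ T ih =>
    rw [Finset.sum_Icc_succ_top (by omega), Finset.sum_Icc_succ_top (by omega),
      Nat.add_sub_cancel]
    linarith

/-- The mean minimizes the sum of squared distances: deviations from it sum to zero, so the cross
term vanishes. -/
lemma spread_le (y : ℕ → Fin m → ℝ) (x : Fin n → ℝ) :
    spread K T y ≤ ∑ t ∈ Finset.Icc 1 T, sqNorm ((K * pinv K).mulVec (y t) - K.mulVec x) := by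
  set c := (1 / (T : ℝ)) • ∑ u ∈ Finset.Icc 1 T, y u with hc
  set P := K * pinv K
  have h1 : ∑ t ∈ Finset.Icc 1 T, P.mulVec (y t - c) = 0 := by
    rw [← mulVec_sum, Finset.sum_sub_distrib, Finset.sum_const, Nat.card_Icc,
      Nat.add_sub_cancel]
    rcases Nat.eq_zero_or_pos T with rfl | hT
    · simp
    rw [hc, ← Nat.cast_smul_eq_nsmul ℝ, smul_smul, mul_one_div_cancel (by positivity), one_smul,
      sub_self, mulVec_zero]
  have h2 : ∑ t ∈ Finset.Icc 1 T, (P.mulVec (y t - c)) ⬝ᵥ (P.mulVec c - K.mulVec x) = 0 := by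
    rw [← sum_dotProduct, h1, zero_dotProduct]
  have h3 : ∀ t, sqNorm (P.mulVec (y t - c)) ≤ sqNorm (P.mulVec (y t) - K.mulVec x)
      - 2 * ((P.mulVec (y t - c)) ⬝ᵥ (P.mulVec c - K.mulVec x)) := by
    intro t
    have : P.mulVec (y t) - K.mulVec x = P.mulVec (y t - c) + (P.mulVec c - K.mulVec x) := by
      rw [mulVec_sub]; abel
    rw [this, sqNorm_add]
    have := sqNorm_nonneg (P.mulVec c - K.mulVec x)
    linarith
  refine (Finset.sum_le_sum fun t _ => h3 t).trans_eq ?_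
  rw [Finset.sum_sub_distrib, ← Finset.mul_sum, h2, mul_zero, sub_zero]

/-- Tracking the targets exactly beats the static optimum when the targets are spread out. -/
lemma optCost_le_staCost_add (hK : IsUnit (K.transpose * K)) (hβ : 0 ≤ β)
    (y : ℕ → Fin m → ℝ) :
    optCost K β T y ≤ staCost K β T y + (4 * constB K β ^ 2 * T - 1 / 4 * spread K T y) := by
  rw [← sub_le_iff_le_add]
  refine le_ciInf fun x => ?_
  set B := constB K β with hB
  have hB0 : 0 ≤ B := mul_nonneg hβ (pinvNorm_nonneg K)
  set v : ℕ → Fin m → ℝ := fun t => (K * pinv K).mulVec (y t) - K.mulVec x with hv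
  -- The value `0` at time `0` makes the index shift in `hsum` lossless there; the first switch is
  -- charged to `β * l1Norm x` instead.
  set u : ℕ → ℝ := fun t => if t = 0 then 0 else √(sqNorm (v t)) with hu
  have hu0 : ∀ t, 0 ≤ u t := by
    intro t; simp only [hu]; split_ifs <;> positivity
  set X : ℕ → Fin n → ℝ := fun t => if t = 0 then 0 else (pinv K).mulVec (y t) with hX
  have hXx : ∀ t, 1 ≤ t → β * l1Norm (X t - x) ≤ B * u t := by
    intro t ht
    have h1 : X t - x = (pinv K).mulVec (v t) := by
      simp only [hX, hv]
      rw [if_neg (by omega), mulVec_sub, pinv_mulVec_mulVec hK, mulVec_mulVec, pinv_mul_proj hK]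
    have h2 := mul_le_mul_of_nonneg_left (l1Norm_pinv_mulVec_le K (v t)) hβ
    rw [← mul_assoc] at h2
    simp only [hu]
    rwa [h1, if_neg (by omega)]
  have hswitch : ∀ t, 1 ≤ t → β * l1Norm (X t - X (t - 1)) ≤
      B * u t + B * u (t - 1) + if t = 1 then β * l1Norm x else 0 := by
    intro t ht
    rcases eq_or_ne t 1 with rfl | h1
    · have h2 := mul_le_mul_of_nonneg_left (l1Norm_add_le (X 1 - x) x) hβ
      rw [sub_add_cancel] at h2
      have h3 := hXx 1 le_rfl
      have h4 : X (1 - 1) = 0 := by simp [hX]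
      have h5 : u (1 - 1) = 0 := by simp [hu]
      rw [h4, sub_zero, h5, if_pos rfl]
      linarith
    · have h2 := mul_le_mul_of_nonneg_left (l1Norm_sub_le (X t - x) (X (t - 1) - x)) hβ
      rw [sub_sub_sub_cancel_right] at h2
      have h3 := hXx t ht
      have h4 := hXx (t - 1) (by omega)
      rw [if_neg h1]
      linarith
  have hsum := sum_pred_add_apply u T
  have hu00 : u 0 = 0 := by simp [hu]
  have hone : ∑ t ∈ Finset.Icc 1 T, (if t = 1 then β * l1Norm x else 0) ≤ β * l1Norm x := by
    rw [Finset.sum_ite_eq']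
    split_ifs
    · exact le_rfl
    · exact mul_nonneg hβ (l1Norm_nonneg _)
  have hcost : cost K β T y X ≤ ∑ t ∈ Finset.Icc 1 T,
      (1 / 2 * sqNorm (y t - (K * pinv K).mulVec (y t)) + (B * u t + B * u (t - 1) +
        if t = 1 then β * l1Norm x else 0)) := by
    rw [cost, costOn]
    refine Finset.sum_le_sum fun t ht => ?_
    have ht' := (Finset.mem_Icc.1 ht).1
    refine add_le_add (le_of_eq ?_) (hswitch t ht')
    simp only [hX]
    rw [if_neg (by omega), mulVec_mulVec]
  -- Each `u t` pays for two switches. The bound `2 B u ≤ 4 B² + u² / 4` leaves a quarter of `u²` as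
  -- the gain over the static action.
  have hyoung : ∀ t ∈ Finset.Icc 1 T, 1 / 2 * sqNorm (y t - (K * pinv K).mulVec (y t))
      + 2 * (B * u t) ≤ 1 / 2 * sqNorm (y t - K.mulVec x) + (4 * B ^ 2 - 1 / 4 * sqNorm (v t)) := by
    intro t ht
    have h1 := sqNorm_sub_mulVec hK (y t) x
    have h2 : u t ^ 2 = sqNorm (v t) := by
      simp only [hu]
      rw [if_neg (by have := (Finset.mem_Icc.1 ht).1; omega), Real.sq_sqrt (sqNorm_nonneg _)]
    rw [h1]
    have h3 := sq_nonneg (u t - 4 * B)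
    simp only [hv] at h2 ⊢
    linarith
  have h1 := Finset.sum_le_sum hyoung
  have h2 := optCost_le_cost (K := K) (T := T) hβ y (x := X) (by simp [hX])
  have h3 := spread_le (K := K) (T := T) y x
  simp only [Finset.sum_add_distrib, Finset.sum_sub_distrib, ← Finset.mul_sum,
    Finset.sum_const, Nat.card_Icc, Nat.add_sub_cancel, nsmul_eq_mul] at h1 hcost ⊢
  rw [hu00] at hsum
  have h4 : B * ∑ t ∈ Finset.Icc 1 T, u (t - 1) ≤ B * ∑ t ∈ Finset.Icc 1 T, u t :=
    mul_le_mul_of_nonneg_left (by have := hu0 T; linarith) hB0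
  linarith

/-- Weak duality: lower bound on the cost of any action sequence. -/
lemma sum_dotProduct_sub_le_cost {y g : ℕ → Fin m → ℝ} (hy : y 0 = 0)
    (hg : ∀ t i, |K.transpose.mulVec (g t) i| ≤ β) {x : ℕ → Fin n → ℝ} (hx : x 0 = 0) :
    ∑ t ∈ Finset.Icc 1 T, (g t ⬝ᵥ (y t - y (t - 1)) - 2 * sqNorm (g t)) ≤ cost K β T y x := by
  set r : ℕ → Fin m → ℝ := fun t => y t - K.mulVec (x t) with hr
  have h0 : sqNorm (r 0) = 0 := by simp [hr, hy, hx]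
  -- The target increment splits into `K` times the action increment, paid for by switching through
  -- `hg`, and a residual increment. Young's inequality charges `1/4` to each of the two residuals,
  -- so every residual is charged at most `1/2` in total.
  have hstep : ∀ t, g t ⬝ᵥ (y t - y (t - 1)) - 2 * sqNorm (g t) ≤
      β * l1Norm (x t - x (t - 1)) + 1 / 4 * sqNorm (r t) + 1 / 4 * sqNorm (r (t - 1)) := by
    intro t
    have e : y t - y (t - 1) = K.mulVec (x t - x (t - 1)) + (r t - r (t - 1)) := by
      simp only [hr, mulVec_sub]; abel
    have h1 := (le_abs_self _).trans (abs_dotProduct_le_mul_l1Norm (hg t) (x t - x (t - 1)))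
    rw [mulVec_transpose, ← dotProduct_mulVec] at h1
    have h2 : ∀ z : Fin m → ℝ, g t ⬝ᵥ z ≤ sqNorm (g t) + 1 / 4 * sqNorm z := by
      intro z
      have := dotProduct_le_half_sqNorm ((2 : ℝ) • g t) z
      rw [sqNorm_smul, smul_dotProduct, smul_eq_mul] at this
      linarith
    have h3 := h2 (r t)
    have h4 := h2 (-r (t - 1))
    rw [sqNorm_neg, dotProduct_neg] at h4
    rw [e, dotProduct_add, dotProduct_sub]
    linarith
  have h1 := Finset.sum_le_sum fun t (_ : t ∈ Finset.Icc 1 T) => hstep t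
  have h2 := sum_pred_add_apply (fun t => sqNorm (r t)) T
  have h3 := sqNorm_nonneg (r T)
  rw [cost, costOn]
  simp only [Finset.sum_add_distrib, ← Finset.mul_sum] at h1 ⊢
  linarith

end Offline

/-! ### Independence and second moments -/

section General

variable [mΩ : MeasurableSpace Ω] {μ : Measure Ω}

/-- It suffices to check the π-system of intersections `a ∩ b`, which generates the join. -/
lemma indep_sup_left [IsProbabilityMeasure μ] {m₁ m₂ m₃ : MeasurableSpace Ω} (h₁ : m₁ ≤ mΩ)
    (h₂ : m₂ ≤ mΩ) (h₃ : m₃ ≤ mΩ) (h : Indep m₁ (m₂ ⊔ m₃) μ) (h' : Indep m₂ m₃ μ) :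
    Indep (m₁ ⊔ m₂) m₃ μ := by
  refine IndepSets.indep (p1 := {s | ∃ a b, MeasurableSet[m₁] a ∧ MeasurableSet[m₂] b ∧ s = a ∩ b})
    (p2 := {s | MeasurableSet[m₃] s}) (sup_le h₁ h₂) h₃ ?_ (@MeasurableSpace.isPiSystem_measurableSet Ω m₃) ?_
    (@MeasurableSpace.generateFrom_measurableSet Ω m₃).symm ?_
  · rintro _ ⟨a, b, ha, hb, rfl⟩ _ ⟨a', b', ha', hb', rfl⟩ _
    exact ⟨a ∩ a', b ∩ b', ha.inter ha', hb.inter hb', Set.inter_inter_inter_comm _ _ _ _⟩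
  · refine le_antisymm (sup_le ?_ ?_) (MeasurableSpace.generateFrom_le ?_)
    · exact fun a ha => MeasurableSpace.measurableSet_generateFrom
        ⟨a, Set.univ, ha, @MeasurableSet.univ _ m₂, (Set.inter_univ a).symm⟩
    · exact fun b hb => MeasurableSpace.measurableSet_generateFrom
        ⟨Set.univ, b, @MeasurableSet.univ _ m₁, hb, (Set.univ_inter b).symm⟩
    · rintro _ ⟨a, b, ha, hb, rfl⟩
      exact MeasurableSet.inter ((le_sup_left : m₁ ≤ m₁ ⊔ m₂) a ha)
        ((le_sup_right : m₂ ≤ m₁ ⊔ m₂) b hb)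
  · rw [IndepSets_iff]
    rintro _ c ⟨a, b, ha, hb, rfl⟩ hc
    rw [Indep_iff] at h h'
    have e1 := h a (b ∩ c) ha (MeasurableSet.inter ((le_sup_left : m₂ ≤ m₂ ⊔ m₃) b hb)
      ((le_sup_right : m₃ ≤ m₂ ⊔ m₃) c hc))
    have e2 := h a b ha ((le_sup_left : m₂ ≤ m₂ ⊔ m₃) b hb)
    rw [Set.inter_assoc, e1, e2, h' b c hb hc, mul_assoc]

/-- The cross term has mean zero. Nothing is assumed on the moments of `Z`: if the right side is
finite, then `Z` is square integrable as a difference. -/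
lemma ofReal_integral_sq_le_lintegral_sq_add [IsProbabilityMeasure μ] {X Z : Ω → ℝ}
    (hX : MemLp X 2 μ) (hX0 : ∫ ω, X ω ∂μ = 0) (hZ : AEStronglyMeasurable Z μ)
    (hXZ : IndepFun X Z μ) :
    ENNReal.ofReal (∫ ω, X ω ^ 2 ∂μ) ≤ ∫⁻ ω, ENNReal.ofReal ((X ω + Z ω) ^ 2) ∂μ := by
  by_cases htop : ∫⁻ ω, ENNReal.ofReal ((X ω + Z ω) ^ 2) ∂μ = ⊤
  · rw [htop]; exact le_top
  have hsum : AEStronglyMeasurable (fun ω => X ω + Z ω) μ := hX.1.add hZ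
  have hint : Integrable (fun ω => (X ω + Z ω) ^ 2) μ :=
    (lintegral_ofReal_ne_top_iff_integrable (hsum.pow 2) (ae_of_all _ fun _ => sq_nonneg _)).1 htop
  have hXZ2 : MemLp (fun ω => X ω + Z ω) 2 μ := (memLp_two_iff_integrable_sq hsum).2 hint
  have hZ2 : MemLp Z 2 μ := by
    refine (hXZ2.sub hX).ae_eq (ae_of_all _ fun ω => ?_)
    simp
  rw [← ofReal_integral_eq_lintegral_ofReal hint (ae_of_all _ fun _ => sq_nonneg _)]
  refine ENNReal.ofReal_le_ofReal ?_
  have h1 : ∫ ω, X ω * Z ω ∂μ = 0 := by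
    rw [hXZ.integral_fun_mul_eq_mul_integral hX.1 hZ, hX0, zero_mul]
  have h2 : ∫ ω, (X ω + Z ω) ^ 2 ∂μ = ∫ ω, X ω ^ 2 ∂μ + 2 * ∫ ω, X ω * Z ω ∂μ
      + ∫ ω, Z ω ^ 2 ∂μ := by
    have hm : Integrable (fun ω => 2 * (X ω * Z ω)) μ := (hX.integrable_mul hZ2).const_mul 2
    have hm' : Integrable (fun ω => X ω ^ 2 + 2 * (X ω * Z ω)) μ := hX.integrable_sq.add hm
    rw [← integral_const_mul, ← integral_add hX.integrable_sq hm,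
      ← integral_add hm' hZ2.integrable_sq]
    refine integral_congr_ae (ae_of_all _ fun ω => ?_)
    dsimp only
    ring
  rw [h2, h1]
  have : 0 ≤ ∫ ω, Z ω ^ 2 ∂μ := integral_nonneg fun _ => sq_nonneg _
  linarith

/-- Nonnegativity of the variance of `√X`. -/
lemma integral_sqrt_le_sqrt_integral [IsProbabilityMeasure μ] {X : Ω → ℝ} (hX : Integrable X μ)
    (h0 : ∀ ω, 0 ≤ X ω) :
    Integrable (fun ω => √(X ω)) μ ∧ ∫ ω, √(X ω) ∂μ ≤ √(∫ ω, X ω ∂μ) := by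
  have hmeas : AEStronglyMeasurable (fun ω => √(X ω)) μ :=
    Real.continuous_sqrt.comp_aestronglyMeasurable hX.1
  have hL2 : MemLp (fun ω => √(X ω)) 2 μ := by
    rw [memLp_two_iff_integrable_sq hmeas]
    simpa only [Real.sq_sqrt (h0 _)] using hX
  have hint := hL2.integrable one_le_two
  refine ⟨hint, Real.le_sqrt_of_sq_le ?_⟩
  set c := ∫ ω, √(X ω) ∂μ with hc
  have h1 : 0 ≤ ∫ ω, (X ω - 2 * c * √(X ω) + c ^ 2) ∂μ := by
    refine integral_nonneg fun ω => ?_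
    have := sq_nonneg (√(X ω) - c)
    rw [sub_sq, Real.sq_sqrt (h0 ω)] at this
    dsimp only [Pi.zero_apply]
    linarith
  have h2 : Integrable (fun ω => X ω - 2 * c * √(X ω)) μ := hX.sub (hint.const_mul _)
  rw [integral_add h2 (integrable_const _), integral_sub hX (hint.const_mul _), integral_const_mul, ← hc, integral_const] at h1
  simp at h1
  linarith

lemma MemLp.mulVec {d d' : ℕ} {v : Ω → Fin d → ℝ} (hv : MemLp v 2 μ)
    (A : Matrix (Fin d') (Fin d) ℝ) : MemLp (fun ω => A.mulVec (v ω)) 2 μ :=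
  (LinearMap.toContinuousLinearMap A.mulVecLin).comp_memLp' hv

lemma MemLp.integrable_dotProduct {d : ℕ} {u v : Ω → Fin d → ℝ} (hu : MemLp u 2 μ)
    (hv : MemLp v 2 μ) : Integrable (fun ω => u ω ⬝ᵥ v ω) μ :=
  integrable_finsetSum _ fun i _ => (hu.eval i).integrable_mul (hv.eval i)

lemma MemLp.integrable_sqNorm {d : ℕ} {v : Ω → Fin d → ℝ} (hv : MemLp v 2 μ) :
    Integrable (fun ω => sqNorm (v ω)) μ := by
  simp only [sqNorm_eq_dotProduct]
  exact MemLp.integrable_dotProduct hv hv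

end General

/-! ### Second moments of linear combinations of the noise. -/

section Noise

variable [mΩ : MeasurableSpace Ω] {μ : Measure Ω}
  {R : Matrix (Fin m) (Fin m) ℝ} {e : ℕ → Ω → Fin m → ℝ}

open Matrix

lemma IsNoise.indepFun (he : IsNoise μ R e) {s t : ℕ} (hs : 1 ≤ s) (ht : 1 ≤ t) (hst : s ≠ t) :
    IndepFun (e s) (e t) μ := by
  obtain ⟨s, rfl⟩ := Nat.exists_eq_add_of_le' hs
  obtain ⟨t, rfl⟩ := Nat.exists_eq_add_of_le' ht
  exact he.indep.indepFun (by omega)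

lemma IsNoise.integral_dotProduct_self (he : IsNoise μ R e) {s : ℕ} (hs : 1 ≤ s)
    (M : Matrix (Fin m) (Fin m) ℝ) : ∫ ω, e s ω ⬝ᵥ M.mulVec (e s ω) ∂μ = (R * M).trace := by
  have h := he.memLp s hs
  have hint : ∀ i j, Integrable (fun ω => M i j * (e s ω j * e s ω i)) μ := fun i j =>
    ((h.eval j).integrable_mul (h.eval i)).const_mul _
  have h1 : ∀ ω, e s ω ⬝ᵥ M.mulVec (e s ω) = ∑ i, ∑ j, M i j * (e s ω j * e s ω i) := by
    intro ω
    simp only [dotProduct, mulVec, Finset.mul_sum]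
    exact Finset.sum_congr rfl fun i _ => Finset.sum_congr rfl fun j _ => by ring
  simp_rw [h1]
  rw [integral_finsetSum _ fun i _ => integrable_finsetSum _ fun j _ => hint i j]
  simp_rw [fun i => integral_finsetSum Finset.univ fun j _ => hint i j, integral_const_mul,
    he.cov s hs]
  rw [trace, Finset.sum_comm]
  simp only [diag_apply, Matrix.mul_apply]
  exact Finset.sum_congr rfl fun i _ => Finset.sum_congr rfl fun j _ => mul_comm _ _

/-- Noise at one time is uncorrelated with functions of the noise at another time. -/
lemma IsNoise.integral_dotProduct_eq_zero (he : IsNoise μ R e) {s t : ℕ} (hs : 1 ≤ s)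
    (ht : 1 ≤ t) (hst : s ≠ t) {φ : (Fin m → ℝ) → Fin m → ℝ} (hφ : Measurable φ)
    (M : Matrix (Fin m) (Fin m) ℝ)
    (hint : ∀ i j, Integrable (fun ω => φ (e t ω) i * e s ω j) μ) :
    ∫ ω, φ (e t ω) ⬝ᵥ M.mulVec (e s ω) ∂μ = 0 := by
  have hint' : ∀ i j, Integrable (fun ω => M i j * (φ (e t ω) i * e s ω j)) μ := fun i j =>
    (hint i j).const_mul _
  have h1 : ∀ ω, φ (e t ω) ⬝ᵥ M.mulVec (e s ω) = ∑ i, ∑ j, M i j * (φ (e t ω) i * e s ω j) := by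
    intro ω
    simp only [dotProduct, mulVec, Finset.mul_sum]
    exact Finset.sum_congr rfl fun i _ => Finset.sum_congr rfl fun j _ => by ring
  simp_rw [h1]
  rw [integral_finsetSum _ fun i _ => integrable_finsetSum _ fun j _ => hint' i j]
  refine Finset.sum_eq_zero fun i _ => ?_
  rw [integral_finsetSum _ fun j _ => hint' i j]
  refine Finset.sum_eq_zero fun j _ => ?_
  have hind : IndepFun (fun ω => φ (e t ω) i) (fun ω => e s ω j) μ :=
    (he.indepFun ht hs hst.symm).comp (φ := fun v => φ v i) (ψ := fun v : Fin m → ℝ => v j)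
      ((measurable_pi_apply i).comp hφ) (measurable_pi_apply j)
  rw [integral_const_mul, hind.integral_fun_mul_eq_mul_integral
    ((measurable_pi_apply i).comp (hφ.comp (he.measurable t ht))).aestronglyMeasurable
    ((measurable_pi_apply j).comp (he.measurable s hs)).aestronglyMeasurable, he.mean s hs j,
    mul_zero, mul_zero]

lemma IsNoise.memLp_sum (he : IsNoise μ R e) {d : ℕ} {S : Finset ℕ} (hS : ∀ s ∈ S, 1 ≤ s)
    (A : ℕ → Matrix (Fin d) (Fin m) ℝ) : MemLp (fun ω => ∑ s ∈ S, (A s).mulVec (e s ω)) 2 μ :=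
  memLp_finsetSum S fun s hs => MemLp.mulVec (he.memLp s (hS s hs)) (A s)

/-- Noise terms at different times are uncorrelated, so only the diagonal of the double sum
survives. -/
lemma IsNoise.integral_sqNorm_sum (he : IsNoise μ R e) {d : ℕ} {S : Finset ℕ}
    (hS : ∀ s ∈ S, 1 ≤ s) (A : ℕ → Matrix (Fin d) (Fin m) ℝ) :
    ∫ ω, sqNorm (∑ s ∈ S, (A s).mulVec (e s ω)) ∂μ =
      ∑ s ∈ S, (R * ((A s).transpose * A s)).trace := by
  have h1 : ∀ ω, sqNorm (∑ s ∈ S, (A s).mulVec (e s ω)) =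
      ∑ s ∈ S, ∑ t ∈ S, e s ω ⬝ᵥ ((A s).transpose * A t).mulVec (e t ω) := by
    intro ω
    rw [sqNorm_eq_dotProduct, sum_dotProduct]
    refine Finset.sum_congr rfl fun s _ => ?_
    rw [dotProduct_sum]
    refine Finset.sum_congr rfl fun t _ => ?_
    rw [← mulVec_mulVec, dotProduct_mulVec (e s ω), vecMul_transpose]
  have hint : ∀ s ∈ S, ∀ t ∈ S, Integrable
      (fun ω => e s ω ⬝ᵥ ((A s).transpose * A t).mulVec (e t ω)) μ := fun s hs t ht =>
    MemLp.integrable_dotProduct (he.memLp s (hS s hs)) (MemLp.mulVec (he.memLp t (hS t ht)) _)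
  simp_rw [h1]
  rw [integral_finsetSum _ fun s hs => integrable_finsetSum _ fun t ht => hint s hs t ht]
  refine Finset.sum_congr rfl fun s hs => ?_
  rw [integral_finsetSum _ fun t ht => hint s hs t ht, Finset.sum_eq_single s]
  · exact he.integral_dotProduct_self (hS s hs) _
  · intro t ht hts
    refine he.integral_dotProduct_eq_zero (φ := id) (hS t ht) (hS s hs) hts measurable_id _
      fun i j => ?_
    exact ((he.memLp s (hS s hs)).eval i).integrable_mul ((he.memLp t (hS t ht)).eval j)
  · exact fun h => absurd hs h

/-- The trace is the second moment of `A` applied to `e 1`. -/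
lemma IsNoise.trace_nonneg (he : IsNoise μ R e) {d : ℕ} (A : Matrix (Fin d) (Fin m) ℝ) :
    0 ≤ (R * (A.transpose * A)).trace := by
  have h := he.integral_sqNorm_sum (S := {1}) (by simp) (fun _ => A)
  simp only [Finset.sum_singleton] at h
  rw [← h]
  exact integral_nonneg fun _ => sqNorm_nonneg _

end Noise

/-! ### The prediction errors -/

section Prediction

variable {f : ℕ → Matrix (Fin m) (Fin m) ℝ} {yhat : ℕ → Fin m → ℝ}

open Matrix

lemma target_sub_pred (e : ℕ → Fin m → ℝ) {N t : ℕ} (hNt : N ≤ t) :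
    target f yhat e t - pred f yhat e N t = ∑ s ∈ Finset.Ioc N t, (f (t - s)).mulVec (e s) := by
  have h : Finset.Icc 1 t = Finset.Icc 1 N ∪ Finset.Ioc N t := by
    ext s; simp only [Finset.mem_union, Finset.mem_Icc, Finset.mem_Ioc]; omega
  rw [target, pred, min_eq_left hNt, h, Finset.sum_union]
  · abel
  · rw [Finset.disjoint_left]
    intro s; simp only [Finset.mem_Icc, Finset.mem_Ioc]; omega

lemma pred_congr {e e' : ℕ → Fin m → ℝ} (h : ∀ s, 1 ≤ s → e s = e' s) :
    pred f yhat e = pred f yhat e' := by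
  ext1 τ; ext1 t
  exact congrArg _ (Finset.sum_congr rfl fun s hs => by rw [h s (Finset.mem_Icc.1 hs).1])

lemma continuous_pred (τ t : ℕ) : Continuous fun e => pred f yhat e τ t :=
  continuous_const.add (continuous_finsetSum _ fun s _ =>
    Continuous.matrix_mulVec continuous_const (continuous_apply s))

lemma sum_Ioc_sub (g : ℕ → ℝ) {N t : ℕ} (hNt : N ≤ t) :
    ∑ s ∈ Finset.Ioc N t, g (t - s) = ∑ j ∈ Finset.range (t - N), g j := by
  refine Finset.sum_bij' (fun s _ => t - s) (fun j _ => t - j) ?_ ?_ ?_ ?_ fun _ _ => rfl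
  all_goals
    intro a ha
    simp only [Finset.mem_Ioc, Finset.mem_range] at *
    omega

variable [mΩ : MeasurableSpace Ω] {μ : Measure Ω}
  {R : Matrix (Fin m) (Fin m) ℝ} {e : ℕ → Ω → Fin m → ℝ}

lemma IsNoise.memLp_target [IsProbabilityMeasure μ] (he : IsNoise μ R e) (f : ℕ → Matrix (Fin m) (Fin m) ℝ)
    (yhat : ℕ → Fin m → ℝ) (t : ℕ) :
    MemLp (fun ω => target f yhat (fun s => e s ω) t) 2 μ :=
  (memLp_const (yhat t)).add (he.memLp_sum (S := Finset.Icc 1 t)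
    (fun _ hs => (Finset.mem_Icc.1 hs).1) fun s => f (t - s))

lemma IsNoise.measurable_target (he : IsNoise μ R e) (f : ℕ → Matrix (Fin m) (Fin m) ℝ)
    (yhat : ℕ → Fin m → ℝ) (t : ℕ) :
    Measurable (fun ω => target f yhat (fun s => e s ω) t) := by
  refine measurable_const.add (Finset.measurable_sum _ fun s hs => ?_)
  exact (Continuous.matrix_mulVec continuous_const continuous_id).measurable.comp
    (he.measurable s (Finset.mem_Icc.1 hs).1)

lemma IsNoise.memLp_target_sub_pred (he : IsNoise μ R e) {N t : ℕ} (hNt : N ≤ t) :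
    MemLp (fun ω => target f yhat (fun s => e s ω) t - pred f yhat (fun s => e s ω) N t) 2 μ := by
  simp only [target_sub_pred _ hNt]
  refine he.memLp_sum (fun s hs => ?_) fun s => f (t - s)
  rw [Finset.mem_Ioc] at hs; omega

lemma IsNoise.integral_sqNorm_mulVec_target_sub_pred (he : IsNoise μ R e) {N t : ℕ} (hNt : N ≤ t)
    {d : ℕ} (A : Matrix (Fin d) (Fin m) ℝ) :
    ∫ ω, sqNorm (A.mulVec
        (target f yhat (fun s => e s ω) t - pred f yhat (fun s => e s ω) N t)) ∂μ =
      ∑ j ∈ Finset.range (t - N), (R * ((A * f j).transpose * (A * f j))).trace := by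
  have h := he.integral_sqNorm_sum (S := Finset.Ioc N t)
    (fun s hs => by rw [Finset.mem_Ioc] at hs; omega) fun s => A * f (t - s)
  rw [sum_Ioc_sub (fun j => (R * ((A * f j).transpose * (A * f j))).trace) hNt] at h
  simp only [target_sub_pred _ hNt, mulVec_sum, mulVec_mulVec]
  exact h

lemma IsNoise.integral_sqrt_sqNorm_target_sub_pred_le [IsProbabilityMeasure μ] (he : IsNoise μ R e) {N t w : ℕ}
    (hNt : N ≤ t) (hw : t - N ≤ w + 1) :
    Integrable (fun ω => √(sqNorm (target f yhat (fun s => e s ω) t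
      - pred f yhat (fun s => e s ω) N t))) μ ∧
    ∫ ω, √(sqNorm (target f yhat (fun s => e s ω) t - pred f yhat (fun s => e s ω) N t)) ∂μ ≤
      fNorm R f w := by
  have h := integral_sqrt_le_sqrt_integral
    (MemLp.integrable_sqNorm (he.memLp_target_sub_pred (f := f) (yhat := yhat) hNt))
    fun _ => sqNorm_nonneg _
  refine ⟨h.1, h.2.trans (Real.sqrt_le_sqrt ?_)⟩
  have h1 := he.integral_sqNorm_mulVec_target_sub_pred (f := f) (yhat := yhat) hNt
    (1 : Matrix (Fin m) (Fin m) ℝ)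
  simp only [one_mulVec, Matrix.one_mul] at h1
  rw [h1, Matrix.mul_sum, trace_sum]
  refine Finset.sum_le_sum_of_subset_of_nonneg (fun j hj => ?_) fun j _ _ => he.trace_nonneg _
  rw [Finset.mem_range] at *; omega

lemma sum_range_sum_range (c : ℕ → ℝ) (w : ℕ) :
    ∑ d ∈ Finset.range (w + 1), ∑ j ∈ Finset.range (d + 1), c j =
      ∑ s ∈ Finset.range (w + 1), ((w : ℝ) - s + 1) * c s := by
  induction w with
  | zero => simp
  | succ w ih =>
    rw [Finset.sum_range_succ, ih, Finset.sum_range_succ _ (w + 1), Finset.sum_range_succ _ (w + 1),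
      ← add_assoc, ← Finset.sum_add_distrib]
    congr 1
    · refine Finset.sum_congr rfl fun s _ => ?_
      push_cast; ring
    · push_cast; ring

/-- A time at position `d` of its window has an error with lags `0, …, d`; lag `s` therefore occurs
at `w - s + 1` positions. The projection is symmetric and idempotent. -/
lemma bigF_eq {K : Matrix (Fin m) (Fin n) ℝ} (hK : IsUnit (K.transpose * K)) (w : ℕ) :
    bigF K R f w = ∑ d ∈ Finset.range (w + 1), ∑ j ∈ Finset.range (d + 1),
      (R * ((K * pinv K * f j).transpose * (K * pinv K * f j))).trace := by
  rw [sum_range_sum_range, bigF, Matrix.mul_sum, trace_sum]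
  refine Finset.sum_congr rfl fun s _ => ?_
  rw [Matrix.mul_smul, trace_smul, smul_eq_mul, transpose_mul, transpose_proj,
    Matrix.mul_assoc _ (K * pinv K) (K * pinv K * f s), ← Matrix.mul_assoc (K * pinv K) (K * pinv K),
    proj_mul_proj hK, Matrix.mul_assoc _ (K * pinv K) (f s)]

end Prediction

/-! ### Online algorithms pay for the noise -/

section LowerBound

variable {Ω : Type*} {𝒢 : MeasurableSpace Ω} [mΩ : MeasurableSpace Ω] {μ : Measure Ω}
  {K : Matrix (Fin m) (Fin n) ℝ} {β : ℝ} {f : ℕ → Matrix (Fin m) (Fin m) ℝ}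
  {R : Matrix (Fin m) (Fin m) ℝ} {e : ℕ → Ω → Fin m → ℝ}

open Matrix

lemma IsNoise.comap_le (he : IsNoise μ R e) {s : ℕ} (hs : 1 ≤ s) :
    MeasurableSpace.comap (e s) inferInstance ≤ mΩ := (he.measurable s hs).comap_le

lemma IsNoise.past_le (he : IsNoise μ R e) (h𝒢 : 𝒢 ≤ mΩ) (t : ℕ) :
    𝒢 ⊔ ⨆ s ∈ Finset.Ico 1 t, MeasurableSpace.comap (e s) inferInstance ≤ mΩ :=
  sup_le h𝒢 (iSup₂_le fun _ hs => he.comap_le (Finset.mem_Ico.1 hs).1)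

/-- The noise at time `t` is independent of the information at time `t - 1`. -/
lemma IsNoise.indep_past [IsProbabilityMeasure μ] (he : IsNoise μ R e) (h𝒢 : 𝒢 ≤ mΩ)
    (hind : Indep 𝒢 (⨆ s ≥ 1, MeasurableSpace.comap (e s) inferInstance) μ) {t : ℕ} (ht : 1 ≤ t) :
    Indep (𝒢 ⊔ ⨆ s ∈ Finset.Ico 1 t, MeasurableSpace.comap (e s) inferInstance)
      (MeasurableSpace.comap (e t) inferInstance) μ := by
  refine indep_sup_left h𝒢 (iSup₂_le fun s hs => he.comap_le (Finset.mem_Ico.1 hs).1)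
    (he.comap_le ht) (indep_of_indep_of_le_right hind (sup_le ?_ ?_)) ?_
  · exact iSup₂_le fun s hs => le_iSup₂_of_le s (Finset.mem_Ico.1 hs).1 le_rfl
  · exact le_iSup₂_of_le t ht le_rfl
  · have h1 := indep_iSup_of_disjoint (μ := μ)
      (m := fun s : ℕ => MeasurableSpace.comap (e (s + 1)) inferInstance)
      (fun s => he.comap_le (Nat.le_add_left 1 s)) he.indep
      (S := {s | s + 1 < t}) (T := {t - 1})
      (Set.disjoint_singleton_right.2 fun h => by simp at h; omega)
    refine indep_of_indep_of_le_left (indep_of_indep_of_le_right h1 ?_) ?_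
    · refine le_iSup₂_of_le (t - 1) rfl ?_
      rw [Nat.sub_add_cancel ht]
    · refine iSup₂_le fun s hs => ?_
      rw [Finset.mem_Ico] at hs
      refine le_iSup₂_of_le (s - 1) (by simp; omega) ?_
      rw [Nat.sub_add_cancel hs.1]

lemma measurable_mulVec {d d' : ℕ} (A : Matrix (Fin d') (Fin d) ℝ) :
    Measurable (fun x : Fin d → ℝ => A.mulVec x) :=
  (Continuous.matrix_mulVec continuous_const continuous_id).measurable

/-- No action based on the information at time `t - 1` tracks the target at time `t` with a mean
square error below the variance of the noise. -/
lemma IsNoise.variance_le_tracking [IsProbabilityMeasure μ] (he : IsNoise μ R e) (hf : f 0 = 1)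
    (h𝒢 : 𝒢 ≤ mΩ) (hind : Indep 𝒢 (⨆ s ≥ 1, MeasurableSpace.comap (e s) inferInstance) μ)
    (yhat : ℕ → Fin m → ℝ) {t : ℕ} (ht : 1 ≤ t) {x : Ω → Fin n → ℝ}
    (hx : Measurable[𝒢 ⊔ ⨆ s ∈ Finset.Ico 1 t, MeasurableSpace.comap (e s) inferInstance] x)
    (i : Fin m) : ENNReal.ofReal (R i i) ≤ ∫⁻ ω, ENNReal.ofReal
      ((target f yhat (fun s => e s ω) t - K.mulVec (x ω)) i ^ 2) ∂μ := by
  have hle := he.past_le h𝒢 t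
  -- The part of the residual that is known at time `t - 1`.
  set Z : Ω → Fin m → ℝ := fun ω => yhat t + ∑ s ∈ Finset.Ico 1 t, (f (t - s)).mulVec (e s ω)
    - K.mulVec (x ω) with hZ
  have hZm : Measurable[𝒢 ⊔ ⨆ s ∈ Finset.Ico 1 t, MeasurableSpace.comap (e s) inferInstance] Z := by
    refine Measurable.sub (measurable_const.add (Finset.measurable_sum _ fun s hs => ?_))
      ((measurable_mulVec K).comp hx)
    refine (measurable_mulVec _).comp ?_
    refine Measurable.mono (comap_measurable (e s)) (le_sup_of_le_right ?_) le_rfl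
    exact le_iSup₂_of_le s hs le_rfl
  have hrZ : ∀ ω, (target f yhat (fun s => e s ω) t - K.mulVec (x ω)) i = e t ω i + Z ω i := by
    intro ω
    have h1 : Finset.Icc 1 t = insert t (Finset.Ico 1 t) := by
      ext s; simp only [Finset.mem_insert, Finset.mem_Icc, Finset.mem_Ico]; omega
    simp only [hZ, target]
    rw [h1, Finset.sum_insert (by simp), Nat.sub_self, hf, one_mulVec]
    simp only [Pi.sub_apply, Pi.add_apply]
    ring
  have hI : IndepFun (fun ω => e t ω i) (fun ω => Z ω i) μ := by
    have h1 : Indep (MeasurableSpace.comap (e t) inferInstance)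
        (MeasurableSpace.comap Z inferInstance) μ :=
      indep_of_indep_of_le_right (he.indep_past h𝒢 hind ht).symm hZm.comap_le
    exact IndepFun.comp (φ := fun v : Fin m → ℝ => v i) (ψ := fun v : Fin m → ℝ => v i)
      ((IndepFun_iff_Indep _ _ _).2 h1) (measurable_pi_apply i) (measurable_pi_apply i)
  have hZi : Measurable (fun ω => Z ω i) := (measurable_pi_apply i).comp (hZm.mono hle le_rfl)
  simp only [hrZ]
  refine le_trans (le_of_eq ?_) (ofReal_integral_sq_le_lintegral_sq_add ((he.memLp t ht).eval i)
    (he.mean t ht i) hZi.aestronglyMeasurable hI)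
  rw [← he.cov t ht i i]
  simp only [sq]

/-- Drop the switching cost and sum the coordinatewise variance bounds. The extended integral covers
algorithms of infinite expected cost. -/
lemma IsNoise.lintegral_algCost_ge [IsProbabilityMeasure μ] (he : IsNoise μ R e) (hf : f 0 = 1)
    (hβ : 0 ≤ β) {A : Alg m n Ω} (hA : IsOnline μ e A) (T : ℕ) (yhat : ℕ → Fin m → ℝ) :
    ENNReal.ofReal ((T : ℝ) / 2 * R.trace) ≤
      ∫⁻ ω, ENNReal.ofReal (algCost K β f e A T yhat ω) ∂μ := by
  set r : ℕ → Ω → Fin m → ℝ :=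
    fun t ω => target f yhat (fun s => e s ω) t - K.mulVec (A T yhat t ω) with hr
  have hrm : ∀ t ∈ Finset.Icc 1 T, Measurable (r t) := by
    intro t ht
    have hAt : Measurable (A T yhat t) := by
      obtain ⟨-, 𝒢, h𝒢, -, hmeas⟩ := hA T yhat
      exact Measurable.mono (hmeas t ht) (IsNoise.past_le (mΩ := mΩ) he h𝒢 t) le_rfl
    exact (he.measurable_target f yhat t).sub ((measurable_mulVec K).comp hAt)
  have hkey : ∀ t ∈ Finset.Icc 1 T, ∀ i, ENNReal.ofReal (R i i) ≤
      ∫⁻ ω, ENNReal.ofReal (r t ω i ^ 2) ∂μ := by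
    intro t ht i
    obtain ⟨-, 𝒢, h𝒢, hind, hmeas⟩ := hA T yhat
    exact IsNoise.variance_le_tracking (mΩ := mΩ) he hf h𝒢 hind yhat (Finset.mem_Icc.1 ht).1
      (hmeas t ht) i
  have hRnn : ∀ i, 0 ≤ R i i := fun i => by
    rw [← he.cov 1 le_rfl i i]; exact integral_nonneg fun _ => mul_self_nonneg _
  calc ENNReal.ofReal ((T : ℝ) / 2 * R.trace)
      = ∑ t ∈ Finset.Icc 1 T, ∑ i, ENNReal.ofReal (1 / 2) * ENNReal.ofReal (R i i) := by
        rw [Finset.sum_const, Nat.card_Icc, Nat.add_sub_cancel, ← Finset.mul_sum,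
          ← ENNReal.ofReal_sum_of_nonneg fun i _ => hRnn i, nsmul_eq_mul,
          ← ENNReal.ofReal_natCast, ← ENNReal.ofReal_mul (by norm_num),
          ← ENNReal.ofReal_mul (by positivity), trace]
        simp only [diag_apply]
        congr 1; ring
    _ ≤ ∑ t ∈ Finset.Icc 1 T, ∑ i,
          ENNReal.ofReal (1 / 2) * ∫⁻ ω, ENNReal.ofReal (r t ω i ^ 2) ∂μ :=
        Finset.sum_le_sum fun t ht => Finset.sum_le_sum fun i _ =>
          mul_le_mul_right (hkey t ht i) _
    _ = ∫⁻ ω, ∑ t ∈ Finset.Icc 1 T, ∑ i,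
          ENNReal.ofReal (1 / 2) * ENNReal.ofReal (r t ω i ^ 2) ∂μ := by
        have hm : ∀ t ∈ Finset.Icc 1 T, ∀ i, Measurable fun ω => ENNReal.ofReal (r t ω i ^ 2) :=
          fun t ht i => (((measurable_pi_apply i).comp (hrm t ht)).pow_const 2).ennreal_ofReal
        rw [lintegral_finsetSum' (Finset.Icc 1 T) fun t ht => (Finset.measurable_sum Finset.univ fun i _ =>
          (hm t ht i).const_mul (ENNReal.ofReal (1 / 2))).aemeasurable]
        refine Finset.sum_congr rfl fun t ht => ?_
        rw [lintegral_finsetSum' _ fun i _ => ((hm t ht i).const_mul _).aemeasurable]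
        exact Finset.sum_congr rfl fun i _ => (lintegral_const_mul _ (hm t ht i)).symm
    _ ≤ ∫⁻ ω, ENNReal.ofReal (algCost K β f e A T yhat ω) ∂μ := by
        refine lintegral_mono fun ω => ?_
        simp only [← ENNReal.ofReal_mul (show (0 : ℝ) ≤ 1 / 2 by norm_num)]
        rw [algCost, cost, costOn, ENNReal.ofReal_sum_of_nonneg fun t _ => add_nonneg
          (mul_nonneg (by norm_num) (sqNorm_nonneg _)) (mul_nonneg hβ (l1Norm_nonneg _))]
        refine Finset.sum_le_sum fun t _ => ?_
        rw [← ENNReal.ofReal_sum_of_nonneg fun i _ => by positivity, ← Finset.mul_sum]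
        exact ENNReal.ofReal_le_ofReal
          (le_add_of_nonneg_right (mul_nonneg hβ (l1Norm_nonneg _)))

end LowerBound

/-! ### Expected competitive difference of Averaging Fixed Horizon Control -/

section Difference

variable [mΩ : MeasurableSpace Ω] {μ : Measure Ω}
  {K : Matrix (Fin m) (Fin n) ℝ} {β : ℝ} {f : ℕ → Matrix (Fin m) (Fin m) ℝ}
  {R : Matrix (Fin m) (Fin m) ℝ} {e : ℕ → Ω → Fin m → ℝ}

open Matrix

lemma IsNoise.integrable_half_sum [IsProbabilityMeasure μ] (he : IsNoise μ R e) (T : ℕ) (yhat : ℕ → Fin m → ℝ) :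
    Integrable (fun ω => ∑ t ∈ Finset.Icc 1 T,
      (1 / 2 : ℝ) * sqNorm (target f yhat (fun s => e s ω) t)) μ :=
  integrable_finsetSum _ fun t _ =>
    (MemLp.integrable_sqNorm (he.memLp_target f yhat t)).const_mul _

lemma IsNoise.measurable_target_pi (he : IsNoise μ R e) (yhat : ℕ → Fin m → ℝ) :
    Measurable (fun ω => target f yhat (fun s => e s ω)) :=
  measurable_pi_lambda _ fun t => he.measurable_target f yhat t

lemma IsNoise.integrable_optCostAt [IsProbabilityMeasure μ] (he : IsNoise μ R e) (hβ : 0 ≤ β) (T : ℕ)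
    (yhat : ℕ → Fin m → ℝ) : Integrable (optCostAt K β f e T yhat) μ := by
  refine (he.integrable_half_sum (f := f) T yhat).mono'
    ((measurable_optCost hβ).comp (he.measurable_target_pi yhat)).aestronglyMeasurable
    (ae_of_all _ fun ω => ?_)
  rw [optCostAt, Real.norm_of_nonneg (optCost_nonneg hβ _)]
  exact optCost_le_half_sum hβ _

lemma IsNoise.integrable_staCostAt [IsProbabilityMeasure μ] (he : IsNoise μ R e) (hβ : 0 ≤ β) (T : ℕ)
    (yhat : ℕ → Fin m → ℝ) : Integrable (staCostAt K β f e T yhat) μ := by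
  refine (he.integrable_half_sum (f := f) T yhat).mono'
    ((measurable_staCost hβ).comp (he.measurable_target_pi yhat)).aestronglyMeasurable
    (ae_of_all _ fun ω => ?_)
  rw [staCostAt, Real.norm_of_nonneg (staCost_nonneg hβ _)]
  exact staCost_le_half_sum hβ _

lemma IsNoise.measurable_afhc (he : IsNoise μ R e) (hK : IsUnit (K.transpose * K)) (hβ : 0 ≤ β)
    (w : ℕ) {T t : ℕ} (ht : t ≤ T) (yhat : ℕ → Fin m → ℝ) :
    Measurable (afhc K β f e w T yhat t) := by
  have hcont : Continuous fun v : ℕ → Fin m → ℝ => afhcAction K β T w (pred f yhat v) t := by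
    unfold afhcAction
    refine (continuous_finsetSum _ fun k hk => ?_).const_smul (1 / ((w : ℝ) + 1))
    exact continuous_fhc hK hβ (Finset.mem_range_succ_iff.1 hk) continuous_pred ht
  -- `e 0` need not be measurable, so it is replaced by `0`; predictions do not see it.
  have hmeas : Measurable (fun ω (s : ℕ) => if s = 0 then (0 : Fin m → ℝ) else e s ω) := by
    refine measurable_pi_lambda _ fun s => ?_
    rcases Nat.eq_zero_or_pos s with rfl | hs
    · simp
    · simpa [hs.ne'] using he.measurable s hs
  have heq : afhc K β f e w T yhat t = fun ω => afhcAction K β T w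
      (pred f yhat fun s => if s = 0 then (0 : Fin m → ℝ) else e s ω) t := by
    ext1 ω
    rw [afhc, pred_congr fun s hs => (if_neg (Nat.one_le_iff_ne_zero.1 hs)).symm]
  rw [heq]
  exact hcont.measurable.comp hmeas

lemma IsNoise.measurable_algCost (he : IsNoise μ R e) {A : Alg m n Ω} {T : ℕ}
    {yhat : ℕ → Fin m → ℝ} (hA : ∀ t ≤ T, Measurable (A T yhat t)) :
    Measurable (algCost K β f e A T yhat) := by
  unfold algCost cost costOn
  refine Finset.measurable_sum _ fun t ht => ?_
  have ht' := (Finset.mem_Icc.1 ht).2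
  refine ((continuous_sqNorm.measurable.comp ?_).const_mul _).add
    ((continuous_l1Norm.measurable.comp ?_).const_mul _)
  · exact (he.measurable_target f yhat t).sub
      ((measurable_mulVec K).comp (hA t ht'))
  · exact (hA t ht').sub (hA (t - 1) (by omega))

/-- The pathwise bound `cost_afhcAction_le_optCost_add` is integrated term by term; it also
dominates the cost of AFHC, which gives integrability. -/
lemma IsNoise.afhc_difference [IsProbabilityMeasure μ] (he : IsNoise μ R e) (hK : IsUnit (K.transpose * K)) (hβ : 0 ≤ β)
    (w T : ℕ) (yhat : ℕ → Fin m → ℝ) :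
    Integrable (algCost K β f e (afhc K β f e w) T yhat) μ ∧
      Integrable (optCostAt K β f e T yhat) μ ∧
      ∫ ω, (algCost K β f e (afhc K β f e w) T yhat ω - optCostAt K β f e T yhat ω) ∂μ ≤
        constV K β R f w * T := by
  set B := constB K β with hB
  have hB0 : 0 ≤ B := mul_nonneg hβ (pinvNorm_nonneg K)
  have hw : (0 : ℝ) < w + 1 := by positivity
  have hfn : 0 ≤ fNorm R f w := Real.sqrt_nonneg _
  set c : ℕ → ℝ := fun j =>
    (R * ((K * pinv K * f j).transpose * (K * pinv K * f j))).trace with hc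
  have hc0 : ∀ j, 0 ≤ c j := fun j => he.trace_nonneg _
  set err : ℕ → ℕ → Ω → Fin m → ℝ := fun N t ω =>
    target f yhat (fun s => e s ω) t - pred f yhat (fun s => e s ω) N t with herr
  set g : ℕ → ℕ → Ω → ℝ := fun t k ω =>
    1 / 2 * sqNorm ((K * pinv K).mulVec (err (lastEnd w k t) t ω)) +
      if 2 ≤ t ∧ windowPos w k t = 0 then
        B * √(sqNorm (err (lastEnd w k (t - 1)) (t - 1) ω)) + 3 * B ^ 2
      else 0 with hg
  have hle : ∀ k t, lastEnd w k t ≤ t := fun k t => by unfold lastEnd; omega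
  have hwin : ∀ k t, t - lastEnd w k t ≤ w + 1 := fun k t =>
    (sub_lastEnd_le t).trans (Nat.succ_le_succ (windowPos_le w k t))
  have hint1 : ∀ t k, Integrable (fun ω =>
      1 / 2 * sqNorm ((K * pinv K).mulVec (err (lastEnd w k t) t ω))) μ := fun t k =>
    (MemLp.integrable_sqNorm (MemLp.mulVec (he.memLp_target_sub_pred (hle k t)) _)).const_mul _
  have hsqrt := fun t k => he.integral_sqrt_sqNorm_target_sub_pred_le (f := f) (yhat := yhat)
    (w := w) (hle k t) (hwin k t)
  have hint2 : ∀ t k, Integrable (fun ω => if 2 ≤ t ∧ windowPos w k t = 0 then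
      B * √(sqNorm (err (lastEnd w k (t - 1)) (t - 1) ω)) + 3 * B ^ 2 else 0) μ := by
    intro t k
    split_ifs
    · exact ((hsqrt (t - 1) k).1.const_mul _).add (integrable_const _)
    · exact integrable_zero _ _ _
  have hgint : ∀ t k, Integrable (g t k) μ := fun t k => (hint1 t k).add (hint2 t k)
  -- The right side depends on `k` only through the window position, so that `sum_windowPos`
  -- applies. The bounds are inequalities because a first window may be incomplete.
  have hgle : ∀ t k, ∫ ω, g t k ω ∂μ ≤
      1 / 2 * ∑ j ∈ Finset.range (windowPos w k t + 1), c j +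
        if windowPos w k t = 0 then B * fNorm R f w + 3 * B ^ 2 else 0 := by
    intro t k
    simp only [hg]
    rw [integral_add (hint1 t k) (hint2 t k), integral_const_mul]
    refine add_le_add (mul_le_mul_of_nonneg_left ?_ (by norm_num)) ?_
    · have h1 := he.integral_sqNorm_mulVec_target_sub_pred (f := f) (yhat := yhat) (hle k t)
        (K * pinv K)
      refine h1.le.trans (Finset.sum_le_sum_of_subset_of_nonneg (fun j hj => ?_)
        fun j _ _ => hc0 j)
      have := sub_lastEnd_le (w := w) (k := k) t
      rw [Finset.mem_range] at *
      omega
    · by_cases h1 : windowPos w k t = 0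
      · rw [if_pos h1]
        by_cases h2 : 2 ≤ t
        · simp only [h1, h2, and_self, if_true]
          rw [integral_add ((hsqrt (t - 1) k).1.const_mul _) (integrable_const _),
            integral_const_mul, integral_const]
          have := mul_le_mul_of_nonneg_left (hsqrt (t - 1) k).2 hB0
          simpa using this
        · simp only [h2, false_and, if_false, integral_zero]
          positivity
      · simp [h1]
  set G : Ω → ℝ := fun ω => 1 / ((w : ℝ) + 1) *
    ∑ t ∈ Finset.Icc 1 T, ∑ k ∈ Finset.range (w + 1), g t k ω with hG
  have hGint : Integrable G μ :=
    (integrable_finsetSum _ fun t _ => integrable_finsetSum _ fun k _ => hgint t k).const_mul _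
  have hopt := he.integrable_optCostAt (K := K) (f := f) hβ T yhat
  have hpath : ∀ ω, algCost K β f e (afhc K β f e w) T yhat ω ≤
      optCostAt K β f e T yhat ω + G ω := fun ω =>
    cost_afhcAction_le_optCost_add hK hβ w (pred f yhat fun s => e s ω)
      (target f yhat fun s => e s ω)
  have halg : Integrable (algCost K β f e (afhc K β f e w) T yhat) μ := by
    refine (hopt.add hGint).mono' (he.measurable_algCost fun t ht =>
      he.measurable_afhc hK hβ w ht yhat).aestronglyMeasurable (ae_of_all _ fun ω => ?_)
    rw [algCost, cost, Real.norm_of_nonneg (costOn_nonneg hβ _ _)]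
    exact hpath ω
  refine ⟨halg, hopt, ?_⟩
  have h1 : ∫ ω, (algCost K β f e (afhc K β f e w) T yhat ω - optCostAt K β f e T yhat ω) ∂μ ≤
      ∫ ω, G ω ∂μ :=
    integral_mono (halg.sub hopt) hGint fun ω => by
      have := hpath ω
      dsimp only
      linarith
  refine h1.trans ?_
  simp only [hG]
  rw [integral_const_mul, integral_finsetSum _ fun t _ =>
    integrable_finsetSum _ fun k _ => hgint t k]
  have h2 : ∀ t, ∫ ω, ∑ k ∈ Finset.range (w + 1), g t k ω ∂μ ≤
      1 / 2 * bigF K R f w + (B * fNorm R f w + 3 * B ^ 2) := by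
    intro t
    rw [integral_finsetSum _ fun k _ => hgint t k]
    refine (Finset.sum_le_sum fun k _ => hgle t k).trans_eq ?_
    rw [sum_windowPos w t (fun d => 1 / 2 * ∑ j ∈ Finset.range (d + 1), c j +
      if d = 0 then B * fNorm R f w + 3 * B ^ 2 else 0), Finset.sum_add_distrib,
      ← Finset.mul_sum, bigF_eq hK, Finset.sum_ite_eq', if_pos (by simp)]
  have h3 := Finset.sum_le_sum fun t (_ : t ∈ Finset.Icc 1 T) => h2 t
  rw [Finset.sum_const, Nat.card_Icc, Nat.add_sub_cancel, nsmul_eq_mul] at h3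
  refine (mul_le_mul_of_nonneg_left h3 (by positivity)).trans_eq ?_
  rw [constV]
  field_simp
  ring

/-- Averaging Fixed Horizon Control is constant competitive if the expected dynamic optimum grows
linearly. -/
lemma IsNoise.constantCompetitive_afhc [IsProbabilityMeasure μ] (he : IsNoise μ R e) (hK : IsUnit (K.transpose * K))
    (hβ : 0 ≤ β) (w : ℕ) {c : ℝ} (hc : 0 < c)
    (h : ∀ (T : ℕ) (yhat : ℕ → Fin m → ℝ), c * T ≤ ∫ ω, optCostAt K β f e T yhat ω ∂μ) :
    ConstantCompetitive μ K β f e (afhc K β f e w) := by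
  refine ⟨1 + |constV K β R f w| / c, fun T yhat => ?_⟩
  obtain ⟨h1, h2, h3⟩ := he.afhc_difference (f := f) hK hβ w T yhat
  refine ⟨h1, h2, ?_⟩
  rw [integral_sub h1 h2] at h3
  have h4 : constV K β R f w * T ≤ |constV K β R f w| * T :=
    mul_le_mul_of_nonneg_right (le_abs_self _) (Nat.cast_nonneg T)
  have h5 := mul_le_mul_of_nonneg_left (h T yhat)
    (div_nonneg (abs_nonneg (constV K β R f w)) hc.le)
  rw [← mul_assoc, div_mul_cancel₀ _ hc.ne'] at h5
  linarith

lemma IsNoise.sublinearRegret_afhc [IsProbabilityMeasure μ] (he : IsNoise μ R e) (hK : IsUnit (K.transpose * K))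
    (hβ : 0 ≤ β) (w : ℕ) {g : ℕ → ℝ} (hg : g =o[atTop] (fun T : ℕ => (T : ℝ)))
    (h : ∀ (T : ℕ) (yhat : ℕ → Fin m → ℝ),
      (4 * constV K β R f w + 16 * constB K β ^ 2) * T - g T ≤ expSpread μ K f e T yhat) :
    SublinearRegret μ K β f e (afhc K β f e w) := by
  -- `V T + 4 B² T` minus a quarter of the lower bound on the spread is exactly `g T / 4`.
  refine ⟨fun T => 1 / 4 * g T, hg.const_mul_left _, fun T yhat => ?_⟩
  obtain ⟨h1, h2, h3⟩ := he.afhc_difference (f := f) hK hβ w T yhat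
  have h4 := he.integrable_staCostAt (K := K) (f := f) hβ T yhat
  refine ⟨h1, h4, ?_⟩
  have hspread : Integrable (fun ω => spread K T (target f yhat (fun s => e s ω))) μ := by
    refine integrable_finsetSum _ fun t _ => MemLp.integrable_sqNorm (MemLp.mulVec ?_ _)
    exact (he.memLp_target f yhat t).sub
      ((memLp_finsetSum _ fun u _ => he.memLp_target f yhat u).const_smul (1 / (T : ℝ)))
  have hdiff : Integrable (fun ω => 4 * constB K β ^ 2 * T
      - 1 / 4 * spread K T (target f yhat (fun s => e s ω))) μ :=
    (integrable_const _).sub (hspread.const_mul _)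
  have h5 : ∫ ω, optCostAt K β f e T yhat ω ∂μ ≤ ∫ ω, (staCostAt K β f e T yhat ω +
      (4 * constB K β ^ 2 * T - 1 / 4 * spread K T (target f yhat (fun s => e s ω)))) ∂μ :=
    integral_mono h2 (h4.add hdiff) fun ω => optCost_le_staCost_add hK hβ _
  rw [integral_add h4 hdiff,
    integral_sub (integrable_const _) (hspread.const_mul _), integral_const,
    integral_const_mul] at h5
  have h6 := h T yhat
  rw [expSpread] at h6
  rw [integral_sub h1 h2] at h3
  rw [integral_sub h1 h4]
  simp at h5
  linarith

end Difference

/-! ### Linear growth of the expected dynamic optimum -/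

/-- Time `0` does not enter the cost, so the target there may be normalized to `0`, as weak duality
requires. -/
lemma optCostAt_update {K : Matrix (Fin m) (Fin n) ℝ} {β : ℝ}
    {f : ℕ → Matrix (Fin m) (Fin m) ℝ} {e : ℕ → Ω → Fin m → ℝ} (T : ℕ) (yhat : ℕ → Fin m → ℝ) :
    optCostAt K β f e T (Function.update yhat 0 0) = optCostAt K β f e T yhat := by
  ext1 ω
  refine iInf_congr fun x => costOn_congr (fun t ht => ?_) fun _ _ _ => rfl
  have := (Finset.mem_Icc.1 ht).1
  rw [target, target, Function.update_of_ne (by omega)]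

section Growth

variable [mΩ : MeasurableSpace Ω] {μ : Measure Ω}
  {K : Matrix (Fin m) (Fin n) ℝ} {β : ℝ} {f : ℕ → Matrix (Fin m) (Fin m) ℝ}
  {R : Matrix (Fin m) (Fin m) ℝ} {e : ℕ → Ω → Fin m → ℝ}

open Matrix

lemma target_sub_target (hf : f 0 = 1) (yhat v : ℕ → Fin m → ℝ) {t : ℕ} (ht : 1 ≤ t) :
    target f yhat v t - target f yhat v (t - 1) = (yhat t - yhat (t - 1)) + v t +
      ∑ s ∈ Finset.Ico 1 t, (f (t - s) - f (t - 1 - s)).mulVec (v s) := by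
  have h1 : Finset.Icc 1 t = insert t (Finset.Ico 1 t) := by
    ext s; simp only [Finset.mem_insert, Finset.mem_Icc, Finset.mem_Ico]; omega
  have h2 : Finset.Icc 1 (t - 1) = Finset.Ico 1 t := by
    ext s; simp only [Finset.mem_Icc, Finset.mem_Ico]; omega
  simp only [target, sub_mulVec, Finset.sum_sub_distrib]
  rw [h1, h2, Finset.sum_insert (by simp), Nat.sub_self, hf, one_mulVec]
  abel

/-- Truncation to the interval `[-1, 1]`. -/
def clip (x : ℝ) : ℝ := max (-1) (min 1 x)

lemma measurable_clip : Measurable clip := by unfold clip; fun_prop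

lemma abs_clip_le (x : ℝ) : |clip x| ≤ 1 :=
  abs_le.2 ⟨le_max_left _ _, max_le (by norm_num) (min_le_left _ _)⟩

lemma clip_mul_self_pos {x : ℝ} (hx : x ≠ 0) : 0 < clip x * x := by
  rcases hx.lt_or_gt with h | h
  · exact mul_pos_of_neg_of_neg (max_lt (by norm_num) (min_lt_of_right_lt h)) h
  · exact mul_pos (lt_max_of_lt_right (lt_min zero_lt_one h)) h

/-- The integrand is nonnegative and vanishes only where the coordinate does; if that held almost
surely, the diagonal entry `R i i` would be zero. -/
lemma IsNoise.integral_clip_mul_pos (he : IsNoise μ R e) [IsProbabilityMeasure μ] (i : Fin m) :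
    0 < ∫ ω, clip (e 1 ω i) * e 1 ω i ∂μ := by
  have h1 := he.memLp 1 le_rfl
  have hm : Measurable fun ω => e 1 ω i := (measurable_pi_apply i).comp (he.measurable 1 le_rfl)
  have hint : Integrable (fun ω => clip (e 1 ω i) * e 1 ω i) μ :=
    ((h1.eval i).integrable one_le_two).bdd_mul (c := 1)
      (measurable_clip.comp hm).aestronglyMeasurable (ae_of_all _ fun ω => abs_clip_le _)
  have h0 : ∀ ω, 0 ≤ clip (e 1 ω i) * e 1 ω i := fun ω => by
    rcases eq_or_ne (e 1 ω i) 0 with h | h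
    · simp [h]
    · exact (clip_mul_self_pos h).le
  rw [integral_pos_iff_support_of_nonneg h0 hint, pos_iff_ne_zero]
  intro h
  have h2 : ∀ᵐ ω ∂μ, e 1 ω i * e 1 ω i = 0 := by
    rw [← mem_ae_iff.trans (iff_of_eq (congrArg (μ · = 0) (compl_compl _)))] at h
    filter_upwards [h] with ω hω
    by_contra hne
    exact hω (clip_mul_self_pos (left_ne_zero_of_mul hne)).ne'
  have h3 : R i i = 0 := by
    rw [← he.cov 1 le_rfl i i, integral_congr_ae h2, integral_zero]
  exact he.posDef.diag_pos.ne' h3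

/-- Weak duality is tested with `φ (e t)`. Its mean is zero, so arbitrary increments of `yhat` drop
out; earlier noise drops out by independence; the correlation with `e t` contributes `δ q` per step.
-/
lemma IsNoise.exists_linear_le_integral_optCostAt [IsProbabilityMeasure μ] (he : IsNoise μ R e)
    (hf : f 0 = 1) (hβ : 0 < β) (i : Fin m) :
    ∃ c > 0, ∀ (T : ℕ) (yhat : ℕ → Fin m → ℝ), c * T ≤ ∫ ω, optCostAt K β f e T yhat ω ∂μ := by
  set q := ∫ ω, clip (e 1 ω i) * e 1 ω i ∂μ with hq
  set p := ∫ ω, clip (e 1 ω i) ∂μ with hp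
  have hq0 : 0 < q := he.integral_clip_mul_pos i
  set κ := 1 + l1Norm (K i) with hκ
  have hκ0 : 0 < κ := add_pos_of_pos_of_nonneg one_pos (l1Norm_nonneg _)
  -- The first bound makes `φ` dual feasible, the second makes the penalty `8 δ²` at most half of
  -- the gain `δ q`.
  set δ := min (β / (2 * κ)) (q / 16) with hδ
  have hδ0 : 0 < δ := lt_min (by positivity) (by positivity)
  have hδβ : 2 * δ * κ ≤ β := by
    have := min_le_left (β / (2 * κ)) (q / 16)
    rw [← hδ, le_div_iff₀ (by positivity)] at this
    linarith
  have hδq : δ ≤ q / 16 := min_le_right _ _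
  have hp1 : |p| ≤ 1 := by
    have := norm_integral_le_of_norm_le_const (μ := μ) (f := fun ω => clip (e 1 ω i)) (C := 1)
      (ae_of_all _ fun ω => abs_clip_le _)
    simpa using this
  -- Clipping keeps the dual vector bounded for unbounded noise, and subtracting `p` centres it.
  set φ : (Fin m → ℝ) → Fin m → ℝ := fun v => Pi.single i (δ * (clip (v i) - p)) with hφ
  have hφi : ∀ v : Fin m → ℝ, |δ * (clip (v i) - p)| ≤ 2 * δ := by
    intro v
    rw [abs_mul, abs_of_pos hδ0, mul_comm]
    refine mul_le_mul_of_nonneg_right ?_ hδ0.le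
    exact (abs_sub _ _).trans ((add_le_add (abs_clip_le _) hp1).trans_eq (by norm_num))
  have hφm : Measurable φ := by
    refine measurable_pi_lambda _ fun j => ?_
    rcases eq_or_ne j i with rfl | hj
    · simp only [hφ, Pi.single_eq_same]
      exact ((measurable_clip.comp (measurable_pi_apply j)).sub_const p).const_mul δ
    · simp only [hφ, Pi.single_eq_of_ne hj]
      exact measurable_const
  have hφsq : ∀ v, sqNorm (φ v) ≤ 4 * δ ^ 2 := by
    intro v
    rw [sqNorm_eq_dotProduct]
    simp only [hφ, single_dotProduct, Pi.single_eq_same]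
    rw [← sq, ← sq_abs]
    exact (pow_le_pow_left₀ (abs_nonneg _) (hφi v) 2).trans_eq (by ring)
  have hφdual : ∀ v j, |K.transpose.mulVec (φ v) j| ≤ β := by
    intro v j
    have h1 : K.transpose.mulVec (φ v) j = K i j * (δ * (clip (v i) - p)) := by
      simp only [hφ, mulVec, dotProduct_single, transpose_apply]
    rw [h1, abs_mul]
    have h2 : |K i j| ≤ κ := (abs_apply_le_l1Norm (K i) j).trans (by rw [hκ]; linarith)
    refine (mul_le_mul h2 (hφi v) (abs_nonneg _) hκ0.le).trans ?_
    linarith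
  have hφL2 : ∀ t, 1 ≤ t → MemLp (fun ω => φ (e t ω)) 2 μ := by
    intro t ht
    refine MemLp.of_bound (hφm.comp (he.measurable t ht)).aestronglyMeasurable (2 * δ)
      (ae_of_all _ fun ω => (pi_norm_le_iff_of_nonneg (by positivity)).2 fun j => ?_)
    rcases eq_or_ne j i with rfl | hj
    · simpa only [hφ, Pi.single_eq_same, Real.norm_eq_abs] using hφi (e t ω)
    · simp only [hφ, Pi.single_eq_of_ne hj, norm_zero]
      positivity
  have hclip : ∀ t, 1 ≤ t → Integrable (fun ω => clip (e t ω i)) μ := by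
    intro t ht
    exact Integrable.of_bound (measurable_clip.comp ((measurable_pi_apply i).comp
      (he.measurable t ht))).aestronglyMeasurable 1 (ae_of_all _ fun ω => abs_clip_le _)
  have hconst : ∀ t, 1 ≤ t → ∀ z : Fin m → ℝ, ∫ ω, φ (e t ω) ⬝ᵥ z ∂μ = 0 := by
    intro t ht z
    have h1 : ∫ ω, clip (e t ω i) ∂μ = p :=
      ((he.ident t ht).comp (measurable_clip.comp (measurable_pi_apply i))).integral_eq
    simp only [hφ, single_dotProduct]
    rw [integral_mul_const, integral_const_mul, integral_sub (hclip t ht) (integrable_const _), h1]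
    simp
  have hself : ∀ t, 1 ≤ t → ∫ ω, φ (e t ω) ⬝ᵥ e t ω ∂μ = δ * q := by
    intro t ht
    have h1 : ∫ ω, clip (e t ω i) * e t ω i ∂μ = q :=
      ((he.ident t ht).comp (u := fun v : Fin m → ℝ => clip (v i) * v i)
        ((measurable_clip.comp (measurable_pi_apply i)).mul (measurable_pi_apply i))).integral_eq
    have hei := ((he.memLp t ht).eval i).integrable one_le_two
    have h2 : Integrable (fun ω => clip (e t ω i) * e t ω i) μ :=
      hei.bdd_mul (c := 1) (hclip t ht).1 (ae_of_all _ fun ω => abs_clip_le _)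
    simp only [hφ, single_dotProduct, mul_assoc, sub_mul]
    rw [integral_const_mul, integral_sub h2 (hei.const_mul p), h1, integral_const_mul,
      he.mean t ht i, mul_zero, sub_zero]
  refine ⟨δ * q / 2, by positivity, fun T yhat => ?_⟩
  rw [← optCostAt_update]
  set y0 := Function.update yhat 0 0 with hy0
  set y : ℕ → Ω → Fin m → ℝ := fun t ω => target f y0 (fun s => e s ω) t with hy
  have hinc : ∀ t, 1 ≤ t → Integrable (fun ω => φ (e t ω) ⬝ᵥ (y t ω - y (t - 1) ω)) μ ∧
      ∫ ω, φ (e t ω) ⬝ᵥ (y t ω - y (t - 1) ω) ∂μ = δ * q := by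
    intro t ht
    have h1 : Integrable (fun ω => φ (e t ω) ⬝ᵥ (y0 t - y0 (t - 1))) μ :=
      MemLp.integrable_dotProduct (hφL2 t ht) (memLp_const _)
    have h2 : Integrable (fun ω => φ (e t ω) ⬝ᵥ e t ω) μ :=
      MemLp.integrable_dotProduct (hφL2 t ht) (he.memLp t ht)
    have h3 : ∀ s ∈ Finset.Ico 1 t, Integrable
        (fun ω => φ (e t ω) ⬝ᵥ (f (t - s) - f (t - 1 - s)).mulVec (e s ω)) μ := fun s hs =>
      MemLp.integrable_dotProduct (hφL2 t ht)
        (MemLp.mulVec (he.memLp s (Finset.mem_Ico.1 hs).1) _)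
    have h12 : Integrable (fun ω => φ (e t ω) ⬝ᵥ (y0 t - y0 (t - 1)) + φ (e t ω) ⬝ᵥ e t ω) μ :=
      h1.add h2
    simp only [hy, target_sub_target hf y0 _ ht, dotProduct_add, dotProduct_sum]
    refine ⟨h12.add (integrable_finsetSum _ h3), ?_⟩
    rw [integral_add h12 (integrable_finsetSum _ h3), integral_add h1 h2, hconst t ht, hself t ht,
      integral_finsetSum _ h3, zero_add, Finset.sum_eq_zero, add_zero]
    intro s hs
    rw [Finset.mem_Ico] at hs
    exact he.integral_dotProduct_eq_zero hs.1 ht (by omega) hφm _ fun j k =>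
      ((hφL2 t ht).eval j).integrable_mul ((he.memLp s hs.1).eval k)
  have hpath : ∀ ω, ∑ t ∈ Finset.Icc 1 T,
      (φ (e t ω) ⬝ᵥ (y t ω - y (t - 1) ω) - 8 * δ ^ 2) ≤ optCostAt K β f e T y0 ω := by
    intro ω
    refine le_optCost fun x hx => le_trans (Finset.sum_le_sum fun t _ => ?_)
      (sum_dotProduct_sub_le_cost (y := target f y0 (fun s => e s ω)) (g := fun t => φ (e t ω))
        (by simp [target, hy0]) (fun t => hφdual (e t ω)) hx)
    have := hφsq (e t ω)
    simp only [hy]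
    linarith
  have hsub : ∀ t ∈ Finset.Icc 1 T,
      Integrable (fun ω => φ (e t ω) ⬝ᵥ (y t ω - y (t - 1) ω) - 8 * δ ^ 2) μ := fun t ht =>
    (hinc t (Finset.mem_Icc.1 ht).1).1.sub (integrable_const _)
  refine le_trans ?_ (integral_mono (integrable_finsetSum _ hsub)
    (he.integrable_optCostAt hβ.le T y0) hpath)
  rw [integral_finsetSum _ hsub]
  have hterm : ∀ t ∈ Finset.Icc 1 T, δ * q / 2 ≤
      ∫ ω, (φ (e t ω) ⬝ᵥ (y t ω - y (t - 1) ω) - 8 * δ ^ 2) ∂μ := by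
    intro t ht
    obtain ⟨h1, h2⟩ := hinc t (Finset.mem_Icc.1 ht).1
    rw [integral_sub h1 (integrable_const _), h2, integral_const]
    have := mul_le_mul_of_nonneg_left hδq hδ0.le
    simp
    linarith
  have := Finset.card_nsmul_le_sum _ _ _ hterm
  rw [Nat.card_Icc, Nat.add_sub_cancel, nsmul_eq_mul] at this
  linarith

/-- Without target coordinates nothing grows linearly, but `constV` vanishes and AFHC is optimal in
expectation. -/
lemma constantCompetitive_afhc_of_isEmpty [IsProbabilityMeasure μ] (he : IsNoise μ R e)
    (hK : IsUnit (K.transpose * K)) (hβ : 0 ≤ β) (hm : m = 0) (w : ℕ) :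
    ConstantCompetitive μ K β f e (afhc K β f e w) := by
  subst hm
  have hV : constV K β R f w = 0 := by
    have h1 : pinvNorm K = 0 := by
      have : {r : ℝ | ∃ v : Fin 0 → ℝ, sqNorm v ≤ 1 ∧ r = l1Norm ((pinv K).mulVec v)} = {0} := by
        ext r
        constructor
        · rintro ⟨v, -, rfl⟩
          rw [Subsingleton.elim v 0]
          simp
        · rintro rfl
          exact ⟨0, by rw [sqNorm_zero]; exact zero_le_one, by rw [Matrix.mulVec_zero, l1Norm_zero]⟩
      rw [pinvNorm, this, csSup_singleton]
    simp [constV, constB, h1, bigF, trace]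
  refine ⟨1, fun T yhat => ?_⟩
  obtain ⟨h1, h2, h3⟩ := he.afhc_difference (f := f) hK hβ w T yhat
  refine ⟨h1, h2, ?_⟩
  rw [integral_sub h1 h2, hV] at h3
  linarith

/-- The given algorithm pays linearly by the lower bound and at most `C` times the optimum, so the
expected optimum grows linearly. -/
lemma IsNoise.constantCompetitive_afhc_of_online [IsProbabilityMeasure μ] (he : IsNoise μ R e)
    (hK : IsUnit (K.transpose * K)) (hf : f 0 = 1) (hβ : 0 ≤ β) {A : Alg m n Ω}
    (hA : IsOnline μ e A) (hcomp : ConstantCompetitive μ K β f e A) (w : ℕ) :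
    ConstantCompetitive μ K β f e (afhc K β f e w) := by
  rcases Nat.eq_zero_or_pos m with hm | hm
  · exact constantCompetitive_afhc_of_isEmpty he hK hβ hm w
  have : Nonempty (Fin m) := ⟨⟨0, hm⟩⟩
  obtain ⟨C, hC⟩ := hcomp
  have htr : 0 < R.trace := Finset.sum_pos (fun _ _ => he.posDef.diag_pos) Finset.univ_nonempty
  have hbound : ∀ (T : ℕ) (yhat : ℕ → Fin m → ℝ),
      (T : ℝ) / 2 * R.trace ≤ C * ∫ ω, optCostAt K β f e T yhat ω ∂μ := by
    intro T yhat
    obtain ⟨h1, -, h3⟩ := hC T yhat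
    have h4 := he.lintegral_algCost_ge (K := K) hf hβ hA T yhat
    have h5 : ∀ ω, 0 ≤ algCost K β f e A T yhat ω := fun ω => costOn_nonneg hβ _ _
    rw [← ofReal_integral_eq_lintegral_ofReal h1 (ae_of_all _ h5),
      ENNReal.ofReal_le_ofReal_iff (integral_nonneg h5)] at h4
    exact h4.trans h3
  -- The horizon `T = 1` suffices: the left side of `hbound` is positive and the expected optimum is
  -- nonnegative.
  have hC0 : 0 < C := by
    have h1 := hbound 1 0
    have h2 : 0 ≤ ∫ ω, optCostAt K β f e 1 0 ω ∂μ := integral_nonneg fun ω => optCost_nonneg hβ _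
    rw [Nat.cast_one] at h1
    exact pos_of_mul_pos_left (lt_of_lt_of_le (by positivity) h1) h2
  refine he.constantCompetitive_afhc hK hβ w (c := R.trace / (2 * C)) (by positivity)
    fun T yhat => ?_
  have := hbound T yhat
  rw [div_mul_eq_mul_div, div_le_iff₀ (by positivity)]
  linarith

lemma IsNoise.constantCompetitive_afhc_of_pos [IsProbabilityMeasure μ] (he : IsNoise μ R e)
    (hK : IsUnit (K.transpose * K)) (hf : f 0 = 1) (hβ : 0 < β) (w : ℕ) :
    ConstantCompetitive μ K β f e (afhc K β f e w) := by
  rcases Nat.eq_zero_or_pos m with hm | hm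
  · exact constantCompetitive_afhc_of_isEmpty he hK hβ.le hm w
  obtain ⟨c, hc, h⟩ := he.exists_linear_le_integral_optCostAt (K := K) hf hβ ⟨0, hm⟩
  exact he.constantCompetitive_afhc hK hβ.le w hc h

end Growth

end OCOPred

end

theorem mainTheorem4 {m n : ℕ} {Ω : Type*} [MeasurableSpace Ω] (μ : Measure Ω)
    [IsProbabilityMeasure μ]
    (K : Matrix (Fin m) (Fin n) ℝ) (hK : IsUnit (K.transpose * K))
    (β : ℝ) (hβ : 0 ≤ β)
    (R : Matrix (Fin m) (Fin m) ℝ)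
    (f : ℕ → Matrix (Fin m) (Fin m) ℝ) (hf : f 0 = 1)
    (e : ℕ → Ω → Fin m → ℝ) (he : OCOPred.IsNoise μ R e) :
    -- every online algorithm has expected cost at least linear in the horizon
    (∀ A : OCOPred.Alg m n Ω, OCOPred.IsOnline μ e A → ∀ (T : ℕ) (yhat : ℕ → Fin m → ℝ),
      ENNReal.ofReal ((T : ℝ) / 2 * R.trace) ≤
        ∫⁻ ω, ENNReal.ofReal (OCOPred.algCost K β f e A T yhat ω) ∂μ) ∧
    ∀ w : ℕ,
      -- expected competitive difference of AFHC
      (∀ (T : ℕ) (yhat : ℕ → Fin m → ℝ),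
        Integrable (OCOPred.algCost K β f e (OCOPred.afhc K β f e w) T yhat) μ ∧
        Integrable (OCOPred.optCostAt K β f e T yhat) μ ∧
        ∫ ω, (OCOPred.algCost K β f e (OCOPred.afhc K β f e w) T yhat ω
          - OCOPred.optCostAt K β f e T yhat ω) ∂μ ≤ OCOPred.constV K β R f w * T) ∧
      -- constant competitive ratio, whenever some online algorithm has one
      ((∃ A : OCOPred.Alg m n Ω, OCOPred.IsOnline μ e A ∧
          OCOPred.ConstantCompetitive μ K β f e A) →
        OCOPred.ConstantCompetitive μ K β f e (OCOPred.afhc K β f e w)) ∧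
      -- which is always so if switching is not free
      (0 < β → OCOPred.ConstantCompetitive μ K β f e (OCOPred.afhc K β f e w)) ∧
      -- sublinear regret, whenever the targets are spread out enough
      ((∃ g : ℕ → ℝ, g =o[atTop] (fun T : ℕ => (T : ℝ)) ∧
          ∀ (T : ℕ) (yhat : ℕ → Fin m → ℝ),
            (4 * OCOPred.constV K β R f w + 16 * OCOPred.constB K β ^ 2) * T - g T ≤
              OCOPred.expSpread μ K f e T yhat) →
        OCOPred.SublinearRegret μ K β f e (OCOPred.afhc K β f e w)) := by
  refine ⟨fun A hA T yhat => he.lintegral_algCost_ge hf hβ hA T yhat, fun w =>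
    ⟨fun T yhat => he.afhc_difference hK hβ w T yhat, ?_, ?_, ?_⟩⟩
  · rintro ⟨A, hA, hcomp⟩
    exact he.constantCompetitive_afhc_of_online hK hf hβ hA hcomp w
  · exact fun hβ' => he.constantCompetitive_afhc_of_pos hK hf hβ' w
  · rintro ⟨g, hg, h⟩
    exact he.sublinearRegret_afhc hK hβ w hg h
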